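/- Let $G$ be a connected (finite-dimensional, real) Lie group with Lie algebra $\mathfrak{g}$, and let $G$ act on $\mathfrak{g}^*$ by the coadjoint action $\langle \operatorname{Ad}^*_g\alpha, X\rangle = \langle\alpha,\operatorname{Ad}_{g^{-1}}X\rangle$. A hamiltonian $G$-space is a triple $(M,\omega,\mu)$ where $(M,\omega)$ is a symplectic manifold with a smooth transitive action of $G$ preserving $\omega$, and $\mu:M\to\mathfrak{g}^*$ is a smooth $G$-equivariant map, $\mu(g\cdot p)=\operatorname{Ad}^*_g\mu(p)$, which is a moment map: $d\langle\mu,X\rangle=\iota_{\xi_X}\omega=\omega(\xi_X,\cdot)$ for all $X\in\mathfrak{g}$, where $\xi_X(p)=\frac{d}{dt}\big|_{t=0}\exp(tX)\cdot p$. A coadjoint orbit $\mathcal{O}=G\cdot\alpha\subset\mathfrak{g}^*$ carries the smooth structure of the homogeneous space $G/G_\alpha$ (it has the quotient topology from $G$ and the orbit map $G\to\mathcal{O}$ is a smooth submersion), and the Kirillov--Kostant--Souriau form $\omega_{\mathrm{KKS}}$ on $\mathcal{O}$ is defined by $\omega_{\mathrm{KKS}}(\zeta_X,\zeta_Y)(\beta)=\beta([X,Y])$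 for $\beta\in\mathcal{O}$ and $X,Y\in\mathfrak{g}$, where $\zeta_X$ is the fundamental vector field of $X$ for the coadjoint action on $\mathcal{O}$. Let $(M,\omega,\mu)$ be a simply connected hamiltonian $G$-space. Then there is a coadjoint orbit $\mathcal{O}\subset\mathfrak{g}^*$ such that $(\mathcal{O},\omega_{\mathrm{KKS}},i)$, with $i:\mathcal{O}\to\mathfrak{g}^*$ the inclusion, is a hamiltonian $G$-space, $\mu$ takes its values in $\mathcal{O}$, and $\mu:M\to\mathcal{O}$ is a $G$-equivariant symplectic covering map which makes $M$ the universal cover of $\mathcal{O}$. That is, $\mu:M\to\mathcal{O}$ is a surjective covering map and a $G$-equivariant local diffeomorphism with $\mu^*\omega_{\mathrm{KKS}}=\omega$, and $M$ is simply connected. -/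

import Mathlib

open scoped Manifold ContDiff Bundle

noncomputable section

namespace KKS

/-! ### The coadjoint representation -/

section Coadjoint

variable {E : Type*} [NormedAddCommGroup E] [NormedSpace ℝ E]
  {H : Type*} [TopologicalSpace H] (I : ModelWithCorners ℝ E H)
  {G : Type*} [TopologicalSpace G] [ChartedSpace H G] [Group G]

/-- The adjoint action of `g` on the Lie algebra `𝔤 = T₁G`: the differential at the identity of the
conjugation `h ↦ g h g⁻¹`. -/
def Ad (g : G) : GroupLieAlgebra I G →L[ℝ] GroupLieAlgebra I G :=
  mfderiv I I (fun h : G => g * h * g⁻¹) (1 : G)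

/-- The dual `𝔤*` of the Lie algebra of `G`. -/
abbrev LieDual (G : Type*) [TopologicalSpace G] [ChartedSpace H G] [Group G] : Type _ :=
  Module.Dual ℝ (GroupLieAlgebra I G)

/-- The coadjoint action of `g` on `𝔤*`: `⟨Ad*_g α, X⟩ = ⟨α, Ad_{g⁻¹} X⟩`. -/
def coAd (g : G) (α : LieDual I G) : LieDual I G :=
  α ∘ₗ (Ad I g⁻¹).toLinearMap

/-- The coadjoint orbit of `α`, as a type. -/
def CoadjointOrbit (α : LieDual I G) : Type _ :=
  {β : LieDual I G // ∃ g : G, coAd I g α = β}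

variable {I}

/-- The inclusion of a coadjoint orbit in `𝔤*`. -/
def CoadjointOrbit.incl {α : LieDual I G} (β : CoadjointOrbit I α) : LieDual I G := β.1

/-- The orbit map `g ↦ Ad*_g α` from `G` onto the coadjoint orbit of `α`. -/
def CoadjointOrbit.orbitMap (α : LieDual I G) (g : G) : CoadjointOrbit I α :=
  ⟨coAd I g α, g, rfl⟩

/-- A coadjoint orbit carries the quotient topology from `G`, that is, the topology of the
homogeneous space `G / G_α` (in general it is finer than the subspace topology from `𝔤*`). -/
instance (α : LieDual I G) : TopologicalSpace (CoadjointOrbit I α) :=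
  TopologicalSpace.coinduced (CoadjointOrbit.orbitMap α) inferInstance

theorem Ad_one : Ad I (1 : G) = ContinuousLinearMap.id ℝ _ := by
  have h : (fun h : G => (1 : G) * h * 1⁻¹) = id := by ext x; simp
  unfold Ad
  rw [h]
  exact mfderiv_id

theorem Ad_mul [LieGroup I ∞ G] (g h : G) : Ad I (g * h) = (Ad I g).comp (Ad I h) := by
  have key : ∀ k : G, HasMFDerivAt I I (fun x : G => k * x * k⁻¹) (1 : G) (Ad I k) := by
    intro k
    have hc : ContMDiff I I ∞ (fun x : G => k * x * k⁻¹) :=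
      (contMDiff_const.mul contMDiff_id).mul contMDiff_const
    exact (hc.mdifferentiableAt (by simp)).hasMFDerivAt
  have key' : ∀ y : G, y = 1 → HasMFDerivAt I I (fun x : G => g * x * g⁻¹) y (Ad I g) := by
    rintro _ rfl
    exact key g
  have hcomp := (key' (h * 1 * h⁻¹) (by simp)).comp (1 : G) (key h)
  have hfun : (fun x : G => g * x * g⁻¹) ∘ (fun x : G => h * x * h⁻¹)
      = fun x : G => (g * h) * x * (g * h)⁻¹ := by
    ext x
    simp [mul_assoc]
  rw [hfun] at hcomp
  exact hcomp.mfderiv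

theorem coAd_one (α : LieDual I G) : coAd I (1 : G) α = α := by
  unfold coAd
  rw [inv_one, Ad_one]
  rfl

theorem coAd_mul [LieGroup I ∞ G] (g h : G) (α : LieDual I G) :
    coAd I (g * h) α = coAd I g (coAd I h α) := by
  unfold coAd
  rw [mul_inv_rev, Ad_mul]
  rfl

/-- `G` acts on a coadjoint orbit by the coadjoint action. -/
instance [LieGroup I ∞ G] (α : LieDual I G) : MulAction G (CoadjointOrbit I α) where
  smul g β := ⟨coAd I g β.1, by
    obtain ⟨h, hh⟩ := β.2
    exact ⟨g * h, by rw [coAd_mul, hh]⟩⟩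
  one_smul β := Subtype.ext (coAd_one β.1)
  mul_smul g h β := Subtype.ext (coAd_mul g h β.1)

end Coadjoint

/-! ### Differential 2-forms and symplectic forms -/

section Forms

variable {E : Type*} [NormedAddCommGroup E] [NormedSpace ℝ E]
  {H : Type*} [TopologicalSpace H] (I : ModelWithCorners ℝ E H)
  (M : Type*) [TopologicalSpace M] [ChartedSpace H M]

/-- A field of bilinear forms on the tangent spaces of `M`. -/
abbrev BilinField : Type _ :=
  ∀ p : M, TangentSpace I p →L[ℝ] TangentSpace I p →L[ℝ] ℝ

variable {I M}

/-- The derivative `dφ_p(v)` of a real function `φ` on `M` in the direction of `v`. -/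
def dirDeriv (φ : M → ℝ) (p : M) (v : TangentSpace I p) : ℝ :=
  (mfderiv I 𝓘(ℝ, ℝ) φ p : E →L[ℝ] ℝ) v

/-- The value at `p` of the exterior derivative `dΩ`, evaluated on vector fields `U`, `V`, `W`. -/
def extDerivTwo (Ω : BilinField I M) (U V W : ∀ p : M, TangentSpace I p) (p : M) : ℝ :=
  dirDeriv (fun q => Ω q (V q) (W q)) p (U p)
  - dirDeriv (fun q => Ω q (U q) (W q)) p (V p)
  + dirDeriv (fun q => Ω q (U q) (V q)) p (W p)
  - Ω p (VectorField.mlieBracket I U V p) (W p)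
  + Ω p (VectorField.mlieBracket I U W p) (V p)
  - Ω p (VectorField.mlieBracket I V W p) (U p)

/-- `dΩ = 0`: the form `dΩ` vanishes at every point `p` on all vector fields smooth near `p`. -/
def IsClosedForm [IsManifold I ∞ M] (Ω : BilinField I M) : Prop :=
  ∀ (p : M) (U V W : ∀ q : M, TangentSpace I q),
    ContMDiffAt I I.tangent ∞ (fun q => (⟨q, U q⟩ : TangentBundle I M)) p →
    ContMDiffAt I I.tangent ∞ (fun q => (⟨q, V q⟩ : TangentBundle I M)) p →
    ContMDiffAt I I.tangent ∞ (fun q => (⟨q, W q⟩ : TangentBundle I M)) p →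
    extDerivTwo Ω U V W p = 0

/-- A symplectic form: a smooth, alternating, closed and nondegenerate field of bilinear forms. -/
structure IsSymplecticForm [IsManifold I ∞ M] (Ω : BilinField I M) : Prop where
  smooth : ContMDiff I (I.prod 𝓘(ℝ, E →L[ℝ] E →L[ℝ] ℝ)) ∞
    (fun p => Bundle.TotalSpace.mk' (E →L[ℝ] E →L[ℝ] ℝ)
      (E := fun q : M => TangentSpace I q →L[ℝ] TangentSpace I q →L[ℝ] ℝ) p (Ω p))
  alternating : ∀ (p : M) (v : TangentSpace I p), Ω p v v = 0
  closed : IsClosedForm Ω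
  nondegenerate : ∀ (p : M) (v : TangentSpace I p), (∀ w : TangentSpace I p, Ω p v w = 0) → v = 0

end Forms

/-! ### Hamiltonian `G`-spaces -/

section Hamiltonian

variable {E : Type*} [NormedAddCommGroup E] [NormedSpace ℝ E]
  {H : Type*} [TopologicalSpace H] (I : ModelWithCorners ℝ E H)
  {G : Type*} [TopologicalSpace G] [ChartedSpace H G] [Group G]
  {F : Type*} [NormedAddCommGroup F] [NormedSpace ℝ F]
  {K : Type*} [TopologicalSpace K] (J : ModelWithCorners ℝ F K)
  {M : Type*} [TopologicalSpace M] [ChartedSpace K M] [MulAction G M]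

/-- The fundamental vector field `ξ_X(p) = d/dt (exp(tX) • p)` at `t = 0`, that is, the image of `X`
under the differential at the identity of the map `g ↦ g • p`. -/
def fundamentalField (X : GroupLieAlgebra I G) (p : M) : TangentSpace J p :=
  (mfderiv I J (fun g : G => g • p) (1 : G) : E →L[ℝ] F) X

/-- `(M, Ω, μ)` is a hamiltonian `G`-space: `Ω` is a symplectic form on `M`, the action of `G` is
smooth, transitive and preserves `Ω`, and `μ : M → 𝔤*` is an equivariant moment map. The functions
`φ_X = ⟨μ, X⟩` form the comoment map. -/
structure IsHamiltonianSpace [IsManifold J ∞ M] (Ω : BilinField J M) (μ : M → LieDual I G) :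
    Prop where
  symplectic : IsSymplecticForm Ω
  smooth_action : ContMDiffSMul I J ∞ G M
  homogeneous : MulAction.IsPretransitive G M
  invariant : ∀ (g : G) (p : M) (v w : TangentSpace J p),
    Ω (g • p) (mfderiv J J (fun q : M => g • q) p v) (mfderiv J J (fun q : M => g • q) p w)
      = Ω p v w
  comoment_smooth : ∀ X : GroupLieAlgebra I G, ContMDiff J 𝓘(ℝ, ℝ) ∞ (fun p : M => μ p X)
  moment : ∀ (X : GroupLieAlgebra I G) (p : M) (v : TangentSpace J p),
    dirDeriv (fun q : M => μ q X) p v = Ω p (fundamentalField I J X p) v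
  equivariant : ∀ (g : G) (p : M), μ (g • p) = coAd I g (μ p)

end Hamiltonian

/-! ### The manifold structure and the symplectic form of a coadjoint orbit -/

section Orbit

variable {E : Type*} [NormedAddCommGroup E] [NormedSpace ℝ E]
  {H : Type*} [TopologicalSpace H] {I : ModelWithCorners ℝ E H}
  {G : Type*} [TopologicalSpace G] [ChartedSpace H G] [Group G]
  {F : Type*} [NormedAddCommGroup F] [NormedSpace ℝ F]
  {K : Type*} [TopologicalSpace K] (J : ModelWithCorners ℝ F K)

/-- The charts of `CoadjointOrbit I α` define its structure of homogeneous space `G / G_α`: they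
make it a (Hausdorff, second countable) smooth manifold for which the orbit map from `G` is a smooth
submersion. Since the orbit map is surjective, at most one smooth structure has this property. -/
structure IsOrbitManifold (α : LieDual I G) [ChartedSpace K (CoadjointOrbit I α)] : Prop where
  t2 : T2Space (CoadjointOrbit I α)
  secondCountable : SecondCountableTopology (CoadjointOrbit I α)
  manifold : IsManifold J ∞ (CoadjointOrbit I α)
  smooth_orbitMap : ContMDiff I J ∞ (CoadjointOrbit.orbitMap α)
  submersion_orbitMap : ∀ g : G,
    Function.Surjective (mfderiv I J (CoadjointOrbit.orbitMap α) g)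

/-- `σ` is the Kirillov–Kostant–Souriau form: `σ(ζ_X, ζ_Y)(β) = β([X, Y])`, where `ζ_X` is the
fundamental vector field of the coadjoint action. -/
def IsKKSForm [LieGroup I ∞ G] {α : LieDual I G} [ChartedSpace K (CoadjointOrbit I α)]
    (σ : BilinField J (CoadjointOrbit I α)) : Prop :=
  ∀ (β : CoadjointOrbit I α) (X Y : GroupLieAlgebra I G),
    σ β (fundamentalField I J X β) (fundamentalField I J Y β) = β.incl ⁅X, Y⁆

end Orbit

/-! ### Universal and symplectic coverings -/

section Covering

/-- `f : M → N` exhibits `M` as the universal cover of `N`. -/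
structure IsUniversalCover {M N : Type*} [TopologicalSpace M] [TopologicalSpace N] (f : M → N) :
    Prop where
  simplyConnected : SimplyConnectedSpace M
  covering : IsCoveringMap f
  surjective : Function.Surjective f

variable {E : Type*} [NormedAddCommGroup E] [NormedSpace ℝ E]
  {H : Type*} [TopologicalSpace H] {I : ModelWithCorners ℝ E H}
  {M : Type*} [TopologicalSpace M] [ChartedSpace H M]
  {F : Type*} [NormedAddCommGroup F] [NormedSpace ℝ F]
  {K : Type*} [TopologicalSpace K] {J : ModelWithCorners ℝ F K}
  {N : Type*} [TopologicalSpace N] [ChartedSpace K N]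

/-- `f : (M, Ω) → (N, σ)` is a symplectic covering map: a surjective covering map which is a
smooth local diffeomorphism and satisfies `f^* σ = Ω`. -/
structure IsSymplecticCovering (Ω : BilinField I M) (σ : BilinField J N) (f : M → N) : Prop where
  covering : IsCoveringMap f
  surjective : Function.Surjective f
  localDiffeomorph : IsLocalDiffeomorph I J ∞ f
  pullback : ∀ (p : M) (v w : TangentSpace I p),
    σ (f p) (mfderiv I J f p v) (mfderiv I J f p w) = Ω p v w

end Covering

end KKS

end

/-!
The moment map of a homogeneous hamiltonian `G`-space `M` is a covering of a coadjoint orbit `O`.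

Fix `p₀ : M` and put `α = μ p₀`. Since `G` is transitive on `M` and `μ` is equivariant, `μ` maps `M`
onto the coadjoint orbit `O` of `α`; let `f = momentLift : M → O`.

*Infinitesimal transitivity.* `G` is σ-compact, so by Baire's theorem `g ↦ g • p` is open; by
equivariance it has constant rank, and an open map of constant rank is a submersion
(`surjective_tanMap_orbit`). Hence the fundamental vector fields `ξ_X` span every tangent space of
`M`, and `g ↦ g • p` has local sections.

*The form is given by the moment map.* Differentiating `⟨μ (g • p), X⟩ = ⟨μ p, Ad_{g⁻¹} X⟩` at
`g = 1` gives `Ω(ξ_X, ξ_Y) = ⟨μ, [X, Y]⟩` (`IsHamiltonianSpace.form_fundamentalField`). It needs the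
differential of the adjoint representation (`hasMFDerivAt_adInv`), computed in a chart at `1` from
the second differential of the multiplication.

*The moment map is an immersion.* If `dμ(v) = 0` then `Ω(ξ_X, v) = 0` for all `X`, hence `v = 0`. So
near each point finitely many components `⟨μ, X_i⟩` form a coordinate system of `M`
(`IsHamiltonianSpace.exists_isLocalDiffeomorphAt`). These functions live on `O`, and `f` is open and
continuous because the orbit maps of `M` and of `O` are quotient maps; so the `β ↦ β(X_i)` are
charts of `O`, for which `f` is a local diffeomorphism
(`IsHamiltonianSpace.isLocalDiffeomorph_momentLift`).

*Covering.* Over a small open set `W ⊆ O` the orbit map has a continuous section `s`, and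
`(w, x) ↦ s w • x` is a trivialization `W × f⁻¹(β₀) ≃ f⁻¹(W)`
(`IsHamiltonianSpace.isCoveringMap_momentLift`).

*The form on the orbit.* `df` maps `ξ_X` to `ζ_X`, and `Ω(ξ_X, ξ_Y) = ⟨μ, [X, Y]⟩` depends only on
the image in `O`. So `Ω` descends to a form on `O`, which is the Kirillov–Kostant–Souriau form, and
which inherits smoothness, closedness, nondegeneracy and invariance from `Ω` because `f` is a
surjective local diffeomorphism (`IsPullback.isSymplecticForm`, `IsHamiltonianSpace.isHamiltonianSpace_orbit`).
-/

open scoped Topology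

namespace KKS

/-! ### Maps of constant rank and submersions between vector spaces -/

section Calculus

variable {E : Type*} [NormedAddCommGroup E] [NormedSpace ℝ E]
  {F : Type*} [NormedAddCommGroup F] [NormedSpace ℝ F] [FiniteDimensional ℝ F]

/-- A `C¹` map of locally constant rank which is open at `x` is a submersion at `x`. Let `Q` be a
projection of `F` onto the range of the derivative. By constancy of the rank, `f` is constant along
the fibres of `Q ∘ f`, so the image of a small neighbourhood of `x` meets the fibre of `Q` through
`f x` only in `f x`; openness then forces `Q` to be injective. -/
theorem surjective_fderiv_of_constant_rank [FiniteDimensional ℝ E] {f : E → F} {x : E}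
    (hf : ContDiffAt ℝ 1 f x)
    (hrank : ∀ᶠ y in 𝓝 x, Module.finrank ℝ (LinearMap.range (fderiv ℝ f y).toLinearMap)
      = Module.finrank ℝ (LinearMap.range (fderiv ℝ f x).toLinearMap))
    (hopen : 𝓝 (f x) ≤ Filter.map f (𝓝 x)) :
    Function.Surjective (fderiv ℝ f x) := by
  set A : E →ₗ[ℝ] F := (fderiv ℝ f x).toLinearMap with hA
  set R : Submodule ℝ F := LinearMap.range A with hR
  set K : Submodule ℝ E := LinearMap.ker A with hK
  obtain ⟨Q₀, hQ₀⟩ := LinearMap.exists_leftInverse_of_injective R.subtype R.ker_subtype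
  obtain ⟨P₀, hP₀⟩ := LinearMap.exists_leftInverse_of_injective K.subtype K.ker_subtype
  let Q : F →L[ℝ] R := LinearMap.toContinuousLinearMap Q₀
  let P : E →L[ℝ] K := LinearMap.toContinuousLinearMap P₀
  have hQ : ∀ r : R, Q (r : F) = r := fun r => LinearMap.congr_fun hQ₀ r
  have hP : ∀ k : K, P (k : E) = k := fun k => LinearMap.congr_fun hP₀ k
  have hdim : Module.finrank ℝ E = Module.finrank ℝ (R × K) := by
    rw [Module.finrank_prod, LinearMap.finrank_range_add_finrank_ker]
  let ψ : E → R × K := fun y => (Q (f y), P y)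
  let D : E → E →L[ℝ] R × K := fun y => (Q.comp (fderiv ℝ f y)).prod P
  have hψ : ∀ᶠ y in 𝓝 x, HasFDerivAt ψ (D y) y := by
    filter_upwards [hf.eventually (by simp)] with y hy
    exact (Q.hasFDerivAt.comp y (hy.differentiableAt (by simp)).hasFDerivAt).prodMk P.hasFDerivAt
  have hψ1 : ContDiffAt ℝ 1 ψ x := (Q.contDiff.contDiffAt.comp x hf).prodMk P.contDiff.contDiffAt
  have hDx : Function.Injective (D x).toLinearMap := by
    rw [← LinearMap.ker_eq_bot, LinearMap.ker_eq_bot']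
    intro v hv
    have h1 : Q (A v) = 0 := congrArg Prod.fst hv
    have h2 : P v = 0 := congrArg Prod.snd hv
    have h3 : A v = 0 := by
      have := hQ ⟨A v, LinearMap.mem_range_self A v⟩
      rw [h1] at this
      exact (congrArg Subtype.val this).symm
    have := hP ⟨v, h3⟩
    rw [h2] at this
    exact (congrArg Subtype.val this).symm
  let T : E ≃L[ℝ] R × K := (LinearMap.linearEquivOfInjective _ hDx hdim).toContinuousLinearEquiv
  have hT : (T : E →L[ℝ] R × K) = D x := by
    ext v <;> rfl
  have hDcont : ContinuousAt D x := by
    refine (hψ1.continuousAt_fderiv (by simp)).congr ?_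
    filter_upwards [hψ] with y hy using hy.fderiv
  have hDinv : ∀ᶠ y in 𝓝 x, D y ∈ Set.range
      (ContinuousLinearEquiv.toContinuousLinearMap : (E ≃L[ℝ] R × K) → _) :=
    hDcont.eventually_mem (hT ▸ T.nhds)
  have hker : ∀ᶠ y in 𝓝 x, ∀ v, Q (fderiv ℝ f y v) = 0 → fderiv ℝ f y v = 0 := by
    filter_upwards [hDinv, hrank] with y hy hr
    obtain ⟨S, hS⟩ := hy
    set B : E →ₗ[ℝ] F := (fderiv ℝ f y).toLinearMap with hB
    have hsurj : LinearMap.range (Q₀ ∘ₗ B) = ⊤ := by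
      rw [LinearMap.range_eq_top]
      intro r
      refine ⟨S.symm (r, 0), ?_⟩
      have : D y (S.symm (r, 0)) = (r, 0) := by rw [← hS]; simp
      exact congrArg Prod.fst this
    have e1 := LinearMap.finrank_range_add_finrank_ker (Q₀ ∘ₗ B)
    have e2 := LinearMap.finrank_range_add_finrank_ker B
    rw [hsurj, finrank_top] at e1
    have hle : LinearMap.ker B ≤ LinearMap.ker (Q₀ ∘ₗ B) := LinearMap.ker_le_ker_comp _ _
    have heq := Submodule.eq_of_le_of_finrank_eq hle (by omega)
    intro v hv
    have : v ∈ LinearMap.ker (Q₀ ∘ₗ B) := hv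
    rw [← heq] at this
    exact this
  -- `ψ` is a local diffeomorphism near `x`; in the coordinates it defines, `f` depends only on
  -- the first factor.
  have hstrict : HasStrictFDerivAt ψ (T : E →L[ℝ] R × K) x := by
    rw [hT]
    exact hψ1.hasStrictFDerivAt' hψ.self_of_nhds (by simp)
  let Φ := hstrict.toOpenPartialHomeomorph ψ
  have hxs : x ∈ Φ.source := hstrict.mem_toOpenPartialHomeomorph_source
  have hxt : ψ x ∈ Φ.target := Φ.map_source hxs
  have hsymm : Φ.symm (ψ x) = x := Φ.left_inv hxs
  have hgood := (hψ.and (hDinv.and (hker.and (hf.eventually (by simp)))))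
  rw [← hsymm] at hgood
  have hgood' := (Φ.continuousAt_symm hxt).eventually hgood
  obtain ⟨r, hr, hball⟩ := Metric.eventually_nhds_iff_ball.1
    (hgood'.and (Φ.open_target.mem_nhds hxt))
  have hconst : ∀ (a : R) (b b' : K), (a, b) ∈ Metric.ball (ψ x) r → (a, b') ∈ Metric.ball (ψ x) r →
      f (Φ.symm (a, b)) = f (Φ.symm (a, b')) := by
    intro a b b' hb hb'
    have ha : a ∈ Metric.ball (ψ x).1 r := by
      rw [← ball_prod_same] at hb
      exact hb.1
    have hmem : ∀ c ∈ Metric.ball (ψ x).2 r, (a, c) ∈ Metric.ball (ψ x) r := by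
      intro c hc
      rw [← ball_prod_same]
      exact ⟨ha, hc⟩
    have hder : ∀ c ∈ Metric.ball (ψ x).2 r,
        HasFDerivAt (fun c : K => f (Φ.symm (a, c))) (0 : K →L[ℝ] F) c := by
      intro c hc
      obtain ⟨⟨h1, ⟨S, hS⟩, h3, h4⟩, h5⟩ := hball _ (hmem c hc)
      have hΦ : HasFDerivAt Φ (S : E →L[ℝ] R × K) (Φ.symm (a, c)) := by
        rw [hS]; exact h1
      have h6 := Φ.hasFDerivAt_symm h5 hΦ
      have h7 := (h4.differentiableAt (by simp)).hasFDerivAt.comp (a, c) h6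
      have h8 := h7.comp c (hasFDerivAt_prodMk_right a c)
      refine h8.congr_fderiv (ContinuousLinearMap.ext fun k => h3 _ ?_)
      have : D (Φ.symm (a, c)) (S.symm (0, k)) = (0, k) := by rw [← hS]; simp
      exact congrArg Prod.fst this
    have hb2 : b ∈ Metric.ball (ψ x).2 r := by
      rw [← ball_prod_same] at hb
      exact hb.2
    have hb2' : b' ∈ Metric.ball (ψ x).2 r := by
      rw [← ball_prod_same] at hb'
      exact hb'.2
    exact Metric.isOpen_ball.is_const_of_fderiv_eq_zero (𝕜 := ℝ)
      (convex_ball _ _).isPreconnected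
      (fun c hc => (hder c hc).differentiableAt.differentiableWithinAt)
      (fun c hc => (hder c hc).fderiv) hb2 hb2'
  have hN : ∀ᶠ y in 𝓝 x, y ∈ Φ.source ∧ ψ y ∈ Metric.ball (ψ x) r :=
    Filter.Eventually.and (Φ.open_source.mem_nhds hxs)
      (hψ1.continuousAt.eventually_mem (Metric.ball_mem_nhds _ hr))
  have himg : f '' {y | y ∈ Φ.source ∧ ψ y ∈ Metric.ball (ψ x) r} ∈ 𝓝 (f x) :=
    hopen (Filter.image_mem_map hN)
  -- If `w` were not in the range, `f x + t • (w - Q w)` would be attained near `x` for small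
  -- `t ≠ 0` by openness; such a point lies in the fibre of `Q` through `f x`, where only `f x` is
  -- attained.
  intro w
  set c : F := w - (Q w : F) with hc
  have hQc : Q c = 0 := by rw [hc, map_sub, hQ, sub_self]
  have hline : Filter.Tendsto (fun t : ℝ => f x + t • c) (𝓝[≠] 0) (𝓝 (f x)) := by
    have : Continuous (fun t : ℝ => f x + t • c) := by fun_prop
    simpa using (this.tendsto 0).mono_left nhdsWithin_le_nhds
  obtain ⟨t, ⟨y, ⟨hy1, hy2⟩, hy3⟩, ht⟩ :=
    ((hline.eventually_mem himg).and self_mem_nhdsWithin).exists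
  have hQy : Q (f y) = Q (f x) := by rw [hy3, map_add, map_smul, hQc, smul_zero, add_zero]
  have hfy : f y = f x := by
    have e1 : Φ.symm (Q (f x), P y) = y := by rw [← hQy]; exact Φ.left_inv hy1
    have e2 : Φ.symm (Q (f x), P x) = x := hsymm
    have hyb : (Q (f x), P y) ∈ Metric.ball (ψ x) r := by rw [← hQy]; exact hy2
    have := hconst (Q (f x)) (P y) (P x) hyb (Metric.mem_ball_self hr)
    rwa [e1, e2] at this
  have hc0 : c = 0 := by
    have : t • c = 0 := by rw [hfy] at hy3; exact left_eq_add.1 hy3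
    exact (smul_eq_zero.1 this).resolve_left ht
  have : w ∈ R := by
    rw [sub_eq_zero.1 (hc.symm.trans hc0)]
    exact (Q w).2
  exact this

/-- A submersion between vector spaces has a continuous local section. -/
theorem exists_local_section_of_surjective_fderiv [CompleteSpace E] {f : E → F} {x : E}
    (hf : ContDiffAt ℝ 1 f x)
    (hsurj : Function.Surjective (fderiv ℝ f x)) :
    ∃ s : F → E, s (f x) = x ∧ ∀ᶠ y in 𝓝 (f x), f (s y) = y ∧ ContinuousAt s y := by
  obtain ⟨L₀, hL₀⟩ := LinearMap.exists_rightInverse_of_surjective (fderiv ℝ f x).toLinearMap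
    (LinearMap.range_eq_top.2 hsurj)
  let L : F →L[ℝ] E := LinearMap.toContinuousLinearMap L₀
  -- the affine right inverse `j` of the derivative makes `f ∘ j` a local homeomorphism
  let j : F → E := fun y => x + L (y - f x)
  have hj0 : j (f x) = x := by simp [j]
  have hj : HasStrictFDerivAt j L (f x) :=
    (L.hasStrictFDerivAt.comp (f x) ((hasStrictFDerivAt_id (f x)).sub_const (f x))).const_add x
  have hfs : HasStrictFDerivAt f (fderiv ℝ f x) (j (f x)) := by
    rw [hj0]; exact hf.hasStrictFDerivAt (by simp)
  have hcomp : HasStrictFDerivAt (f ∘ j) ((ContinuousLinearEquiv.refl ℝ F : F →L[ℝ] F)) (f x) := by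
    exact (hfs.comp (f x) hj).congr_fderiv (ContinuousLinearMap.ext (LinearMap.congr_fun hL₀))
  let Φ := hcomp.toOpenPartialHomeomorph (f ∘ j)
  have hs : f x ∈ Φ.source := hcomp.mem_toOpenPartialHomeomorph_source
  have hΦ : Φ (f x) = f x := congrArg f hj0
  have ht : f x ∈ Φ.target := by
    have := Φ.map_source hs
    rwa [hΦ] at this
  refine ⟨fun y => j (Φ.symm y), ?_, ?_⟩
  · have : Φ.symm (f x) = f x := by
      conv_lhs => rw [← hΦ]
      exact Φ.left_inv hs
    simp only [this, hj0]
  · filter_upwards [Φ.open_target.mem_nhds ht] with y hy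
    refine ⟨Φ.right_inv hy, ?_⟩
    have hjc : Continuous j := by fun_prop
    exact hjc.continuousAt.comp (Φ.continuousAt_symm hy)

end Calculus

/-! ### Tangent maps, the inverse function theorem and the rank theorem on manifolds -/

section Manifold

variable {E : Type*} [NormedAddCommGroup E] [NormedSpace ℝ E]
  {N : Type*} [TopologicalSpace N] [ChartedSpace E N]
  {F : Type*} [NormedAddCommGroup F] [NormedSpace ℝ F]
  {M : Type*} [TopologicalSpace M] [ChartedSpace F M]
  {V : Type*} [NormedAddCommGroup V] [NormedSpace ℝ V]
  {P : Type*} [TopologicalSpace P] [ChartedSpace V P]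

variable (E F) in
/-- The differential of `f` at `x`, as a continuous linear map between the model vector spaces.
Every tangent space is the model space by definition; forgetting the base points allows equalities
between points to be rewritten. -/
noncomputable def tanMap (f : N → M) (x : N) : E →L[ℝ] F :=
  mfderiv 𝓘(ℝ, E) 𝓘(ℝ, F) f x

theorem tanMap_comp {g : M → P} {f : N → M} {x : N}
    (hg : MDifferentiableAt 𝓘(ℝ, F) 𝓘(ℝ, V) g (f x))
    (hf : MDifferentiableAt 𝓘(ℝ, E) 𝓘(ℝ, F) f x) :
    tanMap E V (g ∘ f) x = (tanMap F V g (f x)).comp (tanMap E F f x) :=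
  mfderiv_comp x hg hf

theorem tanMap_id (x : N) : tanMap E E (id : N → N) x = ContinuousLinearMap.id ℝ E :=
  mfderiv_id

theorem tanMap_congr {f g : N → M} {x : N} (h : f =ᶠ[𝓝 x] g) : tanMap E F f x = tanMap E F g x := by
  unfold tanMap
  exact h.mfderiv_eq

theorem tanMap_eq_fderiv_chart {f : N → M} {x : N}
    (hf : MDifferentiableAt 𝓘(ℝ, E) 𝓘(ℝ, F) f x) :
    tanMap E F f x = fderiv ℝ (chartAt F (f x) ∘ f ∘ (chartAt E x).symm) (chartAt E x x) := by
  unfold tanMap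
  rw [hf.mfderiv]
  simp [writtenInExtChartAt, fderivWithin_univ, mfld_simps]

theorem tanMap_eq_fderiv {f : E → F} (x : E) : tanMap E F f x = fderiv ℝ f x := by
  unfold tanMap
  exact mfderiv_eq_fderiv

/-- The map `f` read in the charts at `x` and at `f x`. -/
theorem contDiffAt_chart_comp [IsManifold 𝓘(ℝ, E) ∞ N] [IsManifold 𝓘(ℝ, F) ∞ M] {f : N → M} {x : N}
    (hf : ContMDiff 𝓘(ℝ, E) 𝓘(ℝ, F) ∞ f) :
    ContDiffAt ℝ ∞ (chartAt F (f x) ∘ f ∘ (chartAt E x).symm) (chartAt E x x) := by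
  have := (contMDiffAt_iff.1 (hf x)).2
  simpa [mfld_simps, contDiffWithinAt_univ] using this

/-- The inverse function theorem for maps from a manifold to a vector space. -/
theorem isLocalDiffeomorphAt_of_bijective_tanMap [FiniteDimensional ℝ F] [FiniteDimensional ℝ V]
    [IsManifold 𝓘(ℝ, F) ∞ M]
    {ψ : M → V} {p : M} (hψ : ContMDiff 𝓘(ℝ, F) 𝓘(ℝ, V) ∞ ψ)
    (hbij : Function.Bijective (tanMap F V ψ p)) :
    IsLocalDiffeomorphAt 𝓘(ℝ, F) 𝓘(ℝ, V) ∞ ψ p := by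
  let e := chartAt F p
  let g : F → V := ψ ∘ e.symm
  have hg : ∀ y ∈ e.target, ContDiffAt ℝ ∞ g y := by
    intro y hy
    have h1 : ContMDiffAt 𝓘(ℝ, F) 𝓘(ℝ, V) ∞ (ψ ∘ e.symm) y :=
      (hψ _).comp y ((contMDiffOn_chart_symm (I := 𝓘(ℝ, F)) (n := ∞) (x := p)).contMDiffAt
        (e.open_target.mem_nhds hy))
    exact contMDiffAt_iff_contDiffAt.1 h1
  have het : e p ∈ e.target := mem_chart_target F p
  have hder : fderiv ℝ g (e p) = tanMap F V ψ p := by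
    rw [tanMap_eq_fderiv_chart ((hψ p).mdifferentiableAt (by simp))]
    rfl
  let T : F ≃L[ℝ] V :=
    (LinearEquiv.ofBijective (tanMap F V ψ p).toLinearMap hbij).toContinuousLinearEquiv
  have hT : (T : F →L[ℝ] V) = fderiv ℝ g (e p) := by rw [hder]; rfl
  have hgT : HasFDerivAt g (T : F →L[ℝ] V) (e p) := by
    rw [hT]
    exact ((hg _ het).differentiableAt (by simp)).hasFDerivAt
  let Φ := (hg _ het).toOpenPartialHomeomorph g hgT (by simp)
  have hΦs : e p ∈ Φ.source := (hg _ het).mem_toOpenPartialHomeomorph_source hgT (by simp)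
  -- the open set on which the derivative is invertible
  have hinv : ∀ᶠ y in 𝓝 (e p), fderiv ℝ g y ∈ Set.range
      (ContinuousLinearEquiv.toContinuousLinearMap : (F ≃L[ℝ] V) → _) :=
    ((hg _ het).continuousAt_fderiv (by simp)).eventually_mem (hT ▸ T.nhds)
  obtain ⟨U, hU, hUo, hUp⟩ := eventually_nhds_iff.1 (hinv.and (e.open_target.mem_nhds het))
  let Θ : OpenPartialHomeomorph M V := e.trans (Φ.restrOpen U hUo)
  have hΘ : ∀ x ∈ Θ.source, x ∈ e.source ∧ e x ∈ Φ.source ∧ e x ∈ U := by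
    intro x hx
    have := hx
    simp only [Θ, OpenPartialHomeomorph.trans_source,
      OpenPartialHomeomorph.restrOpen_source] at this
    exact ⟨this.1, this.2.1, this.2.2⟩
  have hΘψ : ∀ x ∈ Θ.source, ψ x = Θ x := fun x hx => by
    change ψ x = ψ (e.symm (e x))
    rw [e.left_inv (hΘ x hx).1]
  refine ⟨{ toPartialEquiv := Θ.toPartialEquiv
            open_source := Θ.open_source
            open_target := Θ.open_target
            contMDiffOn_toFun := hψ.contMDiffOn.congr fun x hx => (hΘψ x hx).symm
            contMDiffOn_invFun := ?_ }, ?_, hΘψ⟩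
  · intro v hv
    have hx := hΘ _ (Θ.map_target hv)
    have hyv : e (Θ.symm v) = Φ.symm v := by
      have h2 : v ∈ (Φ.restrOpen U hUo).target ∧ Φ.symm v ∈ e.target := by
        have := hv
        rw [OpenPartialHomeomorph.trans_target] at this
        exact this
      exact e.right_inv h2.2
    rw [hyv] at hx
    have hvt : v ∈ Φ.target := by
      have h2 : v ∈ (Φ.restrOpen U hUo).target := by
        have := hv
        rw [OpenPartialHomeomorph.trans_target] at this
        exact this.1
      have h3 := (Φ.restrOpen U hUo).map_target h2
      have h4 := (Φ.restrOpen U hUo).right_inv h2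
      rw [OpenPartialHomeomorph.restrOpen_source] at h3
      rw [← h4]
      exact Φ.map_source h3.1
    obtain ⟨⟨S, hS⟩, hyt⟩ := hU _ hx.2.2
    have hS' : HasFDerivAt Φ (S : F →L[ℝ] V) (Φ.symm v) := by
      rw [hS]
      exact ((hg _ hyt).differentiableAt (by simp)).hasFDerivAt
    have h1 : ContDiffAt ℝ ∞ Φ.symm v := Φ.contDiffAt_symm hvt hS' (hg _ hyt)
    have h2 : ContMDiffAt 𝓘(ℝ, F) 𝓘(ℝ, F) ∞ e.symm (Φ.symm v) :=
      (contMDiffOn_chart_symm (I := 𝓘(ℝ, F)) (n := ∞) (x := p)).contMDiffAt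
        (e.open_target.mem_nhds hyt)
    exact (h2.comp v h1.contMDiffAt).contMDiffWithinAt
  · change p ∈ Θ.source
    simp only [Θ, OpenPartialHomeomorph.trans_source, OpenPartialHomeomorph.restrOpen_source]
    exact ⟨mem_chart_source F p, hΦs, hUp⟩

/-- An open smooth map of constant rank between manifolds is a submersion. -/
theorem surjective_tanMap_of_constant_rank [FiniteDimensional ℝ E] [FiniteDimensional ℝ F]
    [IsManifold 𝓘(ℝ, E) ∞ N] [IsManifold 𝓘(ℝ, F) ∞ M]
    {h : N → M} (hh : ContMDiff 𝓘(ℝ, E) 𝓘(ℝ, F) ∞ h) (hopen : IsOpenMap h)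
    (hrank : ∀ x y : N, Module.finrank ℝ (LinearMap.range (tanMap E F h x).toLinearMap)
      = Module.finrank ℝ (LinearMap.range (tanMap E F h y).toLinearMap)) (x : N) :
    Function.Surjective (tanMap E F h x) := by
  let e := chartAt E x
  let e' := chartAt F (h x)
  have hd := fun y => (hh y).mdifferentiableAt (n := ∞) (by simp)
  have hx : x ∈ e.source := mem_chart_source E x
  have hsymm : e.symm (e x) = x := e.left_inv hx
  have het : e x ∈ e.target := e.map_source hx
  have hcont : ContinuousAt (h ∘ e.symm) (e x) :=
    hh.continuous.continuousAt.comp (e.continuousAt_symm het)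
  rw [tanMap_eq_fderiv_chart (hd x)]
  refine surjective_fderiv_of_constant_rank ((contDiffAt_chart_comp hh).of_le (by simp)) ?_ ?_
  · rw [← tanMap_eq_fderiv_chart (hd x)]
    have hev : ∀ᶠ y in 𝓝 (e x), h (e.symm y) ∈ e'.source := by
      refine hcont.eventually_mem (e'.open_source.mem_nhds ?_)
      simp only [Function.comp, hsymm]
      exact mem_chart_source F _
    filter_upwards [hev, e.open_target.mem_nhds het] with y hy hyt
    have h1 : MDifferentiableAt 𝓘(ℝ, E) 𝓘(ℝ, E) e.symm y :=
      mdifferentiableAt_atlas_symm (chart_mem_atlas E x) hyt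
    have h2 : MDifferentiableAt 𝓘(ℝ, F) 𝓘(ℝ, F) e' (h (e.symm y)) :=
      mdifferentiableAt_atlas (chart_mem_atlas F _) hy
    rw [← tanMap_eq_fderiv, tanMap_comp (f := h ∘ e.symm) h2 ((hd _).comp y h1),
      tanMap_comp (hd _) h1, hrank x (e.symm y)]
    have b1 : Function.Surjective (tanMap E E e.symm y) :=
      (mdifferentiable_chart (I := 𝓘(ℝ, E)) x).symm.mfderiv_surjective hyt
    have b2 : Function.Injective (tanMap F F e' (h (e.symm y))) :=
      (mdifferentiable_chart (I := 𝓘(ℝ, F)) (h x)).mfderiv_injective hy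
    have e1 : LinearMap.range ((tanMap F F e' (h (e.symm y))).comp
        ((tanMap E F h (e.symm y)).comp (tanMap E E e.symm y))).toLinearMap
        = (LinearMap.range (tanMap E F h (e.symm y)).toLinearMap).map
          (tanMap F F e' (h (e.symm y))).toLinearMap := by
      ext w
      constructor
      · rintro ⟨v, rfl⟩
        exact ⟨_, ⟨_, rfl⟩, rfl⟩
      · rintro ⟨_, ⟨v, rfl⟩, rfl⟩
        obtain ⟨u, rfl⟩ := b1 v
        exact ⟨u, rfl⟩
    refine Eq.trans (congrArg (fun S : Submodule ℝ F => Module.finrank ℝ S) e1) ?_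
    exact (Submodule.equivMapOfInjective _ b2 _).finrank_eq.symm
  · have k1 : 𝓝 (e x) = Filter.map e (𝓝 x) := (e.map_nhds_eq hx).symm
    have k2 : Filter.map e.symm (𝓝 (e x)) = 𝓝 x := by
      rw [e.symm.map_nhds_eq het]
      rw [hsymm]
    rw [← Filter.map_map, ← Filter.map_map]
    change _ ≤ Filter.map e' (Filter.map h (Filter.map e.symm (𝓝 (e x))))
    rw [k2]
    have k3 : 𝓝 (h x) ≤ Filter.map h (𝓝 x) := hopen.nhds_le x
    have k4 : Filter.map e' (𝓝 (h x)) = 𝓝 (e' (h x)) := e'.map_nhds_eq (mem_chart_source F _)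
    have k5 : (e' ∘ h ∘ e.symm) (e x) = e' (h x) := by simp [hsymm]
    change 𝓝 ((e' ∘ h ∘ e.symm) (e x)) ≤ _
    rw [k5, ← k4]
    exact Filter.map_mono k3

/-- A submersion between manifolds has a continuous local section. -/
theorem exists_local_section_of_surjective_tanMap [FiniteDimensional ℝ E] [FiniteDimensional ℝ F]
    [IsManifold 𝓘(ℝ, E) ∞ N] [IsManifold 𝓘(ℝ, F) ∞ M]
    {h : N → M} (hh : ContMDiff 𝓘(ℝ, E) 𝓘(ℝ, F) ∞ h) {x : N}
    (hsurj : Function.Surjective (tanMap E F h x)) :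
    ∃ s : M → N, s (h x) = x ∧ ∀ᶠ q in 𝓝 (h x), h (s q) = q ∧ ContinuousAt s q := by
  let e := chartAt E x
  let e' := chartAt F (h x)
  have hx : x ∈ e.source := mem_chart_source E x
  have hhx : h x ∈ e'.source := mem_chart_source F _
  have hsymm : e.symm (e x) = x := e.left_inv hx
  have het : e x ∈ e.target := e.map_source hx
  rw [tanMap_eq_fderiv_chart ((hh x).mdifferentiableAt (by simp))] at hsurj
  obtain ⟨s, hs, hsev⟩ := exists_local_section_of_surjective_fderiv
    ((contDiffAt_chart_comp hh).of_le (by simp)) hsurj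
  have hφ : (e' ∘ h ∘ e.symm) (e x) = e' (h x) := by simp [hsymm]
  change s ((e' ∘ h ∘ e.symm) (e x)) = e x at hs
  change ∀ᶠ y in 𝓝 ((e' ∘ h ∘ e.symm) (e x)), e' (h (e.symm (s y))) = y ∧ ContinuousAt s y at hsev
  rw [hφ] at hs hsev
  have hc0 : ContinuousAt s (e' (h x)) := hsev.self_of_nhds.2
  have hc1 : ContinuousAt (fun q => s (e' q)) (h x) := hc0.comp (e'.continuousAt hhx)
  have hc2 : ContinuousAt (fun q => e.symm (s (e' q))) (h x) := by
    refine ContinuousAt.comp (g := e.symm) ?_ hc1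
    rw [hs]
    exact e.continuousAt_symm het
  have hc3 : ContinuousAt (fun q => h (e.symm (s (e' q)))) (h x) :=
    hh.continuous.continuousAt.comp hc2
  refine ⟨fun q => e.symm (s (e' q)), by simp only [hs, hsymm], ?_⟩
  have m1 : ∀ᶠ q in 𝓝 (h x), s (e' q) ∈ e.target :=
    hc1.eventually_mem (e.open_target.mem_nhds (by rw [hs]; exact het))
  have m2 : ∀ᶠ q in 𝓝 (h x), h (e.symm (s (e' q))) ∈ e'.source :=
    hc3.eventually_mem (e'.open_source.mem_nhds (by rw [hs, hsymm]; exact hhx))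
  filter_upwards [m1, m2, e'.open_source.mem_nhds hhx, (e'.continuousAt hhx).eventually hsev]
    with q q1 q2 q3 q4
  refine ⟨e'.injOn q2 q3 q4.1, ?_⟩
  exact ContinuousAt.comp (g := e.symm) (e.continuousAt_symm q1)
    (ContinuousAt.comp (g := s) q4.2 (e'.continuousAt q3))

end Manifold

/-! ### Transitive smooth actions -/

section Action

variable {E : Type*} [NormedAddCommGroup E] [NormedSpace ℝ E]
  {G : Type*} [TopologicalSpace G] [ChartedSpace E G] [Group G]
  {F : Type*} [NormedAddCommGroup F] [NormedSpace ℝ F]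
  {M : Type*} [TopologicalSpace M] [ChartedSpace F M] [MulAction G M]

theorem contMDiff_orbit (hs : ContMDiffSMul 𝓘(ℝ, E) 𝓘(ℝ, F) ∞ G M) (p : M) :
    ContMDiff 𝓘(ℝ, E) 𝓘(ℝ, F) ∞ (fun g : G => g • p) :=
  hs.contMDiff_smul.comp (contMDiff_id.prodMk contMDiff_const)

theorem contMDiff_act (hs : ContMDiffSMul 𝓘(ℝ, E) 𝓘(ℝ, F) ∞ G M) (g : G) :
    ContMDiff 𝓘(ℝ, F) 𝓘(ℝ, F) ∞ (fun p : M => g • p) :=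
  hs.contMDiff_smul.comp (contMDiff_const.prodMk contMDiff_id)

theorem bijective_tanMap_act (hs : ContMDiffSMul 𝓘(ℝ, E) 𝓘(ℝ, F) ∞ G M) (g : G) (p : M) :
    Function.Bijective (tanMap F F (fun q : M => g • q) p) := by
  have hd := fun (g : G) q => (contMDiff_act hs g q).mdifferentiableAt (n := ∞) (by simp)
  have key : ∀ (g : G) (p q : M), g • p = q →
      (tanMap F F (fun q : M => g⁻¹ • q) q).comp (tanMap F F (fun q : M => g • q) p)
        = ContinuousLinearMap.id ℝ F := by
    rintro g p _ rfl
    rw [← tanMap_comp (hd _ _) (hd _ _), ← tanMap_id p]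
    congr 1
    ext q
    simp
  refine ⟨Function.LeftInverse.injective fun v => DFunLike.congr_fun (key g p _ rfl) v,
    fun v => ⟨tanMap F F (fun q : M => g⁻¹ • q) (g • p) v, ?_⟩⟩
  have := DFunLike.congr_fun (key g⁻¹ (g • p) p (by simp)) v
  rw [inv_inv] at this
  exact this

variable [LieGroup 𝓘(ℝ, E) ∞ G]

/-- The differential of the orbit map at `g` is that at the identity, followed by the action
of `g`, up to the translation by `g` on the group. -/
theorem tanMap_orbit_eq (hs : ContMDiffSMul 𝓘(ℝ, E) 𝓘(ℝ, F) ∞ G M) (p : M) (g h : G) :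
    ∃ L : E →L[ℝ] E, Function.Surjective L ∧ tanMap E F (fun k : G => k • p) (g * h) =
      (tanMap F F (fun q : M => g • q) (h • p)).comp
        ((tanMap E F (fun k : G => k • p) h).comp L) := by
  have hm : ∀ a : G, ContMDiff 𝓘(ℝ, E) 𝓘(ℝ, E) ∞ (fun k : G => a * k) :=
    fun a => contMDiff_mul_left
  have hd := fun (a : G) x => (hm a x).mdifferentiableAt (n := ∞) (by simp)
  have hsm : ContMDiffSMul 𝓘(ℝ, E) 𝓘(ℝ, E) ∞ G G := ⟨contMDiff_mul _ _⟩
  refine ⟨tanMap E E (fun k : G => g⁻¹ * k) (g * h), (bijective_tanMap_act hsm g⁻¹ (g * h)).2, ?_⟩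
  have key : ∀ k : G, g⁻¹ * (g * h) = k → tanMap E F (fun k : G => k • p) (g * h) =
      (tanMap F F (fun q : M => g • q) (k • p)).comp ((tanMap E F (fun k : G => k • p) k).comp
        (tanMap E E (fun k : G => g⁻¹ * k) (g * h))) := by
    rintro _ rfl
    rw [← tanMap_comp ((contMDiff_orbit hs p _).mdifferentiableAt (by simp)) (hd _ _)]
    refine Eq.trans ?_ (tanMap_comp (x := g * h) (g := fun q : M => g • q)
      (f := (fun k : G => k • p) ∘ (fun k : G => g⁻¹ * k))
      ((contMDiff_act hs g _).mdifferentiableAt (by simp))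
      (((contMDiff_orbit hs p).comp (hm g⁻¹) _).mdifferentiableAt (by simp)))
    congr 1
    ext k
    simp [smul_smul]
  exact key h (by simp)

variable [FiniteDimensional ℝ E] [FiniteDimensional ℝ F] [SecondCountableTopology G]
  [T2Space M] [MulAction.IsPretransitive G M]

/-- `G` is σ-compact and `M` is a Baire space, so the orbit map is open. -/
theorem isOpenMap_orbit (hs : ContMDiffSMul 𝓘(ℝ, E) 𝓘(ℝ, F) ∞ G M) (p : M) :
    IsOpenMap (fun g : G => g • p) := by
  have := topologicalGroup_of_lieGroup 𝓘(ℝ, E) ∞ (G := G)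
  have := Manifold.locallyCompact_of_finiteDimensional 𝓘(ℝ, E) (M := G)
  have := Manifold.locallyCompact_of_finiteDimensional 𝓘(ℝ, F) (M := M)
  have : ContinuousSMul G M := ⟨hs.contMDiff_smul.continuous⟩
  exact isOpenMap_smul_of_sigmaCompact p

/-- The orbit map of a transitive smooth action of a second countable Lie group is a submersion:
it is open by a Baire category argument, and has constant rank by equivariance. -/
theorem surjective_tanMap_orbit [IsManifold 𝓘(ℝ, F) ∞ M]
    (hs : ContMDiffSMul 𝓘(ℝ, E) 𝓘(ℝ, F) ∞ G M) (p : M) (g : G) :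
    Function.Surjective (tanMap E F (fun g : G => g • p) g) := by
  refine surjective_tanMap_of_constant_rank (contMDiff_orbit hs p) (isOpenMap_orbit hs p) ?_ g
  have key : ∀ a : G,
      Module.finrank ℝ (LinearMap.range (tanMap E F (fun k : G => k • p) a).toLinearMap)
      = Module.finrank ℝ
        (LinearMap.range (tanMap E F (fun k : G => k • p) (1 : G)).toLinearMap) := by
    intro a
    obtain ⟨L, hL, h⟩ := tanMap_orbit_eq hs p a 1
    rw [mul_one] at h
    have e1 : LinearMap.range (tanMap E F (fun k : G => k • p) a).toLinearMap
        = (LinearMap.range (tanMap E F (fun k : G => k • p) (1 : G)).toLinearMap).map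
          (tanMap F F (fun q : M => a • q) ((1 : G) • p)).toLinearMap := by
      rw [h]
      ext w
      constructor
      · rintro ⟨v, rfl⟩
        exact ⟨_, ⟨_, rfl⟩, rfl⟩
      · rintro ⟨_, ⟨v, rfl⟩, rfl⟩
        obtain ⟨u, rfl⟩ := hL v
        exact ⟨u, rfl⟩
    rw [e1]
    exact (Submodule.equivMapOfInjective _ (bijective_tanMap_act hs a _).1 _).finrank_eq.symm
  exact fun x y => (key x).trans (key y).symm

theorem surjective_fundamentalField [IsManifold 𝓘(ℝ, F) ∞ M]
    (hs : ContMDiffSMul 𝓘(ℝ, E) 𝓘(ℝ, F) ∞ G M) (p : M) (v : TangentSpace 𝓘(ℝ, F) p) :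
    ∃ X : GroupLieAlgebra 𝓘(ℝ, E) G, fundamentalField 𝓘(ℝ, E) 𝓘(ℝ, F) X p = v :=
  surjective_tanMap_orbit hs p 1 v

end Action

/-! ### The differential of the adjoint representation -/

section AdjointDerivative

variable {E : Type*} [NormedAddCommGroup E] [NormedSpace ℝ E]
  {G : Type*} [TopologicalSpace G] [ChartedSpace E G] [Group G] [LieGroup 𝓘(ℝ, E) ∞ G]

/-- Implicit differentiation of a linear equation `S x (B x) = w x` at a point where `S = 1`. -/
theorem hasFDerivAt_of_clm_apply_eq [CompleteSpace E] {S : E → E →L[ℝ] E} {w B : E → E} {a : E}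
    {S' : E →L[ℝ] E →L[ℝ] E} {w' : E →L[ℝ] E} (hS : HasFDerivAt S S' a)
    (hSa : S a = ContinuousLinearMap.id ℝ E) (hw : HasFDerivAt w w' a)
    (hB : ∀ᶠ x in 𝓝 a, S x (B x) = w x) : HasFDerivAt B (w' - S'.flip (w a)) a := by
  have hd : DifferentiableAt ℝ B a := by
    have hinv : DifferentiableAt ℝ (Ring.inverse : (E →L[ℝ] E) → (E →L[ℝ] E)) (S a) := by
      rw [hSa]
      exact (hasFDerivAt_ringInverse (𝕜 := ℝ) (1 : (E →L[ℝ] E)ˣ)).differentiableAt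
    have hunit : ∀ᶠ x in 𝓝 a, IsUnit (S x) := by
      refine hS.continuousAt.eventually_mem (Units.isOpen.mem_nhds ?_)
      rw [hSa]
      exact isUnit_one
    refine ((hinv.comp a hS.differentiableAt).clm_apply
      hw.differentiableAt).congr_of_eventuallyEq ?_
    filter_upwards [hunit, hB] with x h1 h2
    rw [← h2]
    exact (DFunLike.congr_fun (Ring.inverse_mul_cancel _ h1) (B x)).symm
  have hBa : B a = w a := by
    have := hB.self_of_nhds
    rwa [hSa] at this
  have h1 := (hS.clm_apply hd.hasFDerivAt).unique (hw.congr_of_eventuallyEq hB)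
  rw [hSa, hBa, ContinuousLinearMap.id_comp] at h1
  rw [← h1, add_sub_cancel_right]
  exact hd.hasFDerivAt

/-- `L_g ∘ Ad_{g⁻¹} = R_g` on `𝔤`, for the differentials of the translations by `g`. -/
theorem tanMap_mul_left_comp_Ad (g : G) :
    (tanMap E E (fun h : G => g * h) 1).comp (Ad 𝓘(ℝ, E) g⁻¹ : E →L[ℝ] E)
      = tanMap E E (fun h : G => h * g) 1 := by
  have hc : ContMDiff 𝓘(ℝ, E) 𝓘(ℝ, E) ∞ (fun h : G => g⁻¹ * h * g⁻¹⁻¹) :=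
    (contMDiff_const.mul contMDiff_id).mul contMDiff_const
  have hl : ContMDiff 𝓘(ℝ, E) 𝓘(ℝ, E) ∞ (fun h : G => g * h) := contMDiff_mul_left
  have key : ∀ k : G, g⁻¹ * 1 * g⁻¹⁻¹ = k → tanMap E E (fun h : G => h * g) 1 =
      (tanMap E E (fun h : G => g * h) k).comp (tanMap E E (fun h : G => g⁻¹ * h * g⁻¹⁻¹) 1) := by
    rintro _ rfl
    rw [← tanMap_comp ((hl _).mdifferentiableAt (by simp)) ((hc 1).mdifferentiableAt (by simp))]
    congr 1
    ext h
    simp [mul_assoc]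
  exact (key 1 (by simp)).symm

variable (E G) in
/-- Multiplication of `G`, read in the chart at the identity. -/
noncomputable def chartMul (z : E × E) : E :=
  chartAt E (1 : G) ((chartAt E (1 : G)).symm z.1 * (chartAt E (1 : G)).symm z.2)

theorem contDiffAt_chartMul : ContDiffAt ℝ ∞ (chartMul E G)
    (chartAt E (1 : G) 1, chartAt E (1 : G) 1) := by
  set e := chartAt E (1 : G)
  have het : e 1 ∈ e.target := mem_chart_target E (1 : G)
  have hes : e.symm (e 1) = 1 := e.left_inv (mem_chart_source E (1 : G))
  have hsymm : ContMDiffAt 𝓘(ℝ, E) 𝓘(ℝ, E) ∞ e.symm (e 1) :=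
    (contMDiffOn_chart_symm (I := 𝓘(ℝ, E)) (n := ∞) (x := (1 : G))).contMDiffAt
      (e.open_target.mem_nhds het)
  have h1 : ContMDiffAt 𝓘(ℝ, E × E) 𝓘(ℝ, E) ∞ (fun z : E × E => e.symm z.1) (e 1, e 1) :=
    hsymm.comp (e 1, e 1) contDiff_fst.contMDiff.contMDiffAt
  have h2 : ContMDiffAt 𝓘(ℝ, E × E) 𝓘(ℝ, E) ∞ (fun z : E × E => e.symm z.2) (e 1, e 1) :=
    hsymm.comp (e 1, e 1) contDiff_snd.contMDiff.contMDiffAt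
  have h3 := h1.mul h2
  have h4 : ContMDiffAt 𝓘(ℝ, E) 𝓘(ℝ, E) ∞ e (e.symm (e 1) * e.symm (e 1)) := by
    rw [hes, mul_one]
    exact contMDiffAt_of_mem_maximalAtlas (IsManifold.chart_mem_maximalAtlas 1)
      (mem_chart_source E (1 : G))
  exact contMDiffAt_iff_contDiffAt.1 (h4.comp (e 1, e 1) h3)

/-- The differential of left translation by the point of coordinates `x`, in the chart at `1`. -/
noncomputable def chartLeft (E G : Type*) [NormedAddCommGroup E] [NormedSpace ℝ E]
    [TopologicalSpace G] [ChartedSpace E G] [Group G] (x : E) : E →L[ℝ] E :=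
  (fderiv ℝ (chartMul E G) (x, chartAt E (1 : G) 1)).comp (ContinuousLinearMap.inr ℝ E E)

/-- The differential of right translation by the point of coordinates `x`, in the chart at `1`. -/
noncomputable def chartRight (E G : Type*) [NormedAddCommGroup E] [NormedSpace ℝ E]
    [TopologicalSpace G] [ChartedSpace E G] [Group G] (x : E) : E →L[ℝ] E :=
  (fderiv ℝ (chartMul E G) (chartAt E (1 : G) 1, x)).comp (ContinuousLinearMap.inl ℝ E E)

theorem tanMap_chart_one : tanMap E E (chartAt E (1 : G)) 1 = ContinuousLinearMap.id ℝ E := by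
  rw [tanMap_eq_fderiv_chart (mdifferentiableAt_atlas (chart_mem_atlas E _) (mem_chart_source E _))]
  have : (chartAt E (chartAt E (1 : G) 1) ∘ chartAt E (1 : G) ∘ (chartAt E (1 : G)).symm)
      =ᶠ[𝓝 (chartAt E (1 : G) 1)] id := by
    filter_upwards [(chartAt E (1 : G)).open_target.mem_nhds (mem_chart_target E (1 : G))] with y hy
    simp [chartAt_self_eq, (chartAt E (1 : G)).right_inv hy]
  rw [this.fderiv_eq, fderiv_id]

theorem eventually_chartLeft_eq : ∀ᶠ x in 𝓝 (chartAt E (1 : G) 1), chartLeft E G x =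
    (tanMap E E (chartAt E (1 : G)) ((chartAt E (1 : G)).symm x)).comp
      (tanMap E E (fun h : G => (chartAt E (1 : G)).symm x * h) 1) := by
  set e := chartAt E (1 : G)
  have het : e 1 ∈ e.target := mem_chart_target E (1 : G)
  have hc := (contDiffAt_chartMul (E := E) (G := G)).of_le (m := 1) (by simp)
  have hev : ∀ᶠ x in 𝓝 (e 1), ContDiffAt ℝ 1 (chartMul E G) (x, e 1) :=
    ((Continuous.prodMk_left (e 1)).tendsto (e 1)).eventually (hc.eventually (by simp))
  filter_upwards [hev, e.open_target.mem_nhds het] with x hx hxt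
  have hgs : e.symm x ∈ e.source := e.map_target hxt
  have hl : ContMDiff 𝓘(ℝ, E) 𝓘(ℝ, E) ∞ (fun h : G => e.symm x * h) := contMDiff_mul_left
  have hl1 := (hl 1).mdifferentiableAt (by simp)
  have he : ∀ k, k = e.symm x → MDifferentiableAt 𝓘(ℝ, E) 𝓘(ℝ, E) e k := by
    rintro _ rfl
    exact mdifferentiableAt_atlas (chart_mem_atlas E _) hgs
  have key : ∀ k, e.symm x * 1 = k → (tanMap E E e k).comp
      (tanMap E E (fun h : G => e.symm x * h) 1) = chartLeft E G x := by
    rintro _ rfl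
    have he' := he _ (mul_one (e.symm x))
    rw [← tanMap_comp he' hl1, tanMap_eq_fderiv_chart (he'.comp 1 hl1)]
    have h1 := (hx.differentiableAt (by simp)).hasFDerivAt.comp (e 1)
      (hasFDerivAt_prodMk_right x (e 1))
    exact h1.fderiv
  exact (key _ (mul_one _)).symm

theorem eventually_chartRight_eq : ∀ᶠ x in 𝓝 (chartAt E (1 : G) 1), chartRight E G x =
    (tanMap E E (chartAt E (1 : G)) ((chartAt E (1 : G)).symm x)).comp
      (tanMap E E (fun h : G => h * (chartAt E (1 : G)).symm x) 1) := by
  set e := chartAt E (1 : G)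
  have het : e 1 ∈ e.target := mem_chart_target E (1 : G)
  have hc := (contDiffAt_chartMul (E := E) (G := G)).of_le (m := 1) (by simp)
  have hev : ∀ᶠ x in 𝓝 (e 1), ContDiffAt ℝ 1 (chartMul E G) (e 1, x) :=
    ((Continuous.prodMk_right (e 1)).tendsto (e 1)).eventually (hc.eventually (by simp))
  filter_upwards [hev, e.open_target.mem_nhds het] with x hx hxt
  have hgs : e.symm x ∈ e.source := e.map_target hxt
  have hl : ContMDiff 𝓘(ℝ, E) 𝓘(ℝ, E) ∞ (fun h : G => h * e.symm x) := contMDiff_mul_right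
  have hl1 := (hl 1).mdifferentiableAt (by simp)
  have he : ∀ k, k = e.symm x → MDifferentiableAt 𝓘(ℝ, E) 𝓘(ℝ, E) e k := by
    rintro _ rfl
    exact mdifferentiableAt_atlas (chart_mem_atlas E _) hgs
  have key : ∀ k, 1 * e.symm x = k → (tanMap E E e k).comp
      (tanMap E E (fun h : G => h * e.symm x) 1) = chartRight E G x := by
    rintro _ rfl
    have he' := he _ (one_mul (e.symm x))
    rw [← tanMap_comp (f := fun h : G => h * e.symm x) he' hl1,
      tanMap_eq_fderiv_chart (he'.comp 1 hl1)]
    have h1 := HasFDerivAt.comp (f := fun y => (y, x)) (e 1)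
      (hx.differentiableAt (by simp)).hasFDerivAt (hasFDerivAt_prodMk_left (e 1) x)
    exact h1.fderiv
  exact (key _ (one_mul _)).symm

theorem chartLeft_one : chartLeft E G (chartAt E (1 : G) 1) = ContinuousLinearMap.id ℝ E := by
  have h := (eventually_chartLeft_eq (E := E) (G := G)).self_of_nhds
  rw [h, (chartAt E (1 : G)).left_inv (mem_chart_source E _), tanMap_chart_one]
  have : (fun h : G => 1 * h) = id := by ext; simp
  rw [this, tanMap_id]
  rfl

theorem chartRight_one : chartRight E G (chartAt E (1 : G) 1) = ContinuousLinearMap.id ℝ E := by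
  have h := (eventually_chartRight_eq (E := E) (G := G)).self_of_nhds
  rw [h, (chartAt E (1 : G)).left_inv (mem_chart_source E _), tanMap_chart_one]
  have : (fun h : G => h * 1) = id := by ext; simp
  rw [this, tanMap_id]
  rfl

/-- Comparison of left and right translations, read in the chart at `1`. -/
theorem eventually_chartLeft_comp_Ad : ∀ᶠ x in 𝓝 (chartAt E (1 : G) 1), ∀ X : E,
    chartLeft E G x (Ad 𝓘(ℝ, E) ((chartAt E (1 : G)).symm x)⁻¹ X : E) = chartRight E G x X := by
  filter_upwards [eventually_chartLeft_eq (E := E) (G := G),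
    eventually_chartRight_eq (E := E) (G := G)] with x h1 h2 X
  rw [h1, h2, ← tanMap_mul_left_comp_Ad]
  rfl

theorem hasFDerivAt_fderiv_chartMul : HasFDerivAt (fderiv ℝ (chartMul E G))
    (fderiv ℝ (fderiv ℝ (chartMul E G)) (chartAt E (1 : G) 1, chartAt E (1 : G) 1))
    (chartAt E (1 : G) 1, chartAt E (1 : G) 1) :=
  (((contDiffAt_chartMul (E := E) (G := G)).fderiv_right (m := 1)
    (WithTop.coe_le_coe.2 le_top)).differentiableAt (by simp)).hasFDerivAt

/-- The second differential of the multiplication at the identity, in the chart at `1`: its mixed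
part. -/
noncomputable def chartMulSnd (E G : Type*) [NormedAddCommGroup E] [NormedSpace ℝ E]
    [TopologicalSpace G] [ChartedSpace E G] [Group G] (u v : E) : E :=
  fderiv ℝ (fderiv ℝ (chartMul E G)) (chartAt E (1 : G) 1, chartAt E (1 : G) 1) (u, 0) (0, v)

theorem exists_hasFDerivAt_chartLeft : ∃ S' : E →L[ℝ] E →L[ℝ] E,
    HasFDerivAt (chartLeft E G) S' (chartAt E (1 : G) 1) ∧
      ∀ u v, S' u v = chartMulSnd E G u v := by
  have h1 := HasFDerivAt.comp (g := fderiv ℝ (chartMul E G))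
    (f := fun x => (x, chartAt E (1 : G) 1)) (chartAt E (1 : G) 1)
    (hasFDerivAt_fderiv_chartMul (E := E) (G := G))
    (hasFDerivAt_prodMk_left (chartAt E (1 : G) 1) (chartAt E (1 : G) 1))
  have h2 := ((ContinuousLinearMap.compL ℝ E (E × E) E).flip
    (ContinuousLinearMap.inr ℝ E E)).hasFDerivAt.comp (chartAt E (1 : G) 1) h1
  exact ⟨_, h2, fun u v => rfl⟩

theorem exists_hasFDerivAt_chartRight : ∃ S' : E →L[ℝ] E →L[ℝ] E,
    HasFDerivAt (chartRight E G) S' (chartAt E (1 : G) 1) ∧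
      ∀ u v, S' u v = chartMulSnd E G v u := by
  have h1 := (hasFDerivAt_fderiv_chartMul (E := E) (G := G)).comp (chartAt E (1 : G) 1)
    (hasFDerivAt_prodMk_right (chartAt E (1 : G) 1) (chartAt E (1 : G) 1))
  have h2 := ((ContinuousLinearMap.compL ℝ E (E × E) E).flip
    (ContinuousLinearMap.inl ℝ E E)).hasFDerivAt.comp (chartAt E (1 : G) 1) h1
  refine ⟨_, h2, fun u v => ?_⟩
  have hs := (contDiffAt_chartMul (E := E) (G := G)).isSymmSndFDerivAt
    (by rw [minSmoothness_of_isRCLikeNormedField]; exact WithTop.coe_le_coe.2 le_top)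
  exact hs (0, u) (v, 0)

theorem inverse_tanMap_chart_symm {x : E} (hx : x ∈ (chartAt E (1 : G)).target) :
    (tanMap E E (chartAt E (1 : G)).symm x).inverse
      = tanMap E E (chartAt E (1 : G)) ((chartAt E (1 : G)).symm x) := by
  set e := chartAt E (1 : G)
  have hgs : e.symm x ∈ e.source := e.map_target hx
  have h1 : MDifferentiableAt 𝓘(ℝ, E) 𝓘(ℝ, E) e.symm x :=
    mdifferentiableAt_atlas_symm (chart_mem_atlas E _) hx
  have h2 : MDifferentiableAt 𝓘(ℝ, E) 𝓘(ℝ, E) e (e.symm x) :=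
    mdifferentiableAt_atlas (chart_mem_atlas E _) hgs
  refine ContinuousLinearMap.inverse_eq ?_ ?_
  · have key : ∀ y, e (e.symm x) = y → (tanMap E E e.symm y).comp (tanMap E E e (e.symm x))
        = ContinuousLinearMap.id ℝ E := by
      rintro _ rfl
      have h1' : MDifferentiableAt 𝓘(ℝ, E) 𝓘(ℝ, E) e.symm (e (e.symm x)) := by
        rw [e.right_inv hx]; exact h1
      rw [← tanMap_comp h1' h2, ← tanMap_id (e.symm x)]
      refine tanMap_congr ?_
      filter_upwards [e.open_source.mem_nhds hgs] with y hy using e.left_inv hy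
    exact key x (e.right_inv hx)
  · rw [← tanMap_comp h2 h1, ← tanMap_id x]
    refine tanMap_congr ?_
    filter_upwards [e.open_target.mem_nhds hx] with y hy using e.right_inv hy

/-- The Lie bracket of `𝔤` is the antisymmetrization of the mixed second differential of the
multiplication. -/
theorem bracket_eq_chartMulSnd (X Y : GroupLieAlgebra 𝓘(ℝ, E) G) :
    (⁅X, Y⁆ : GroupLieAlgebra 𝓘(ℝ, E) G) = (chartMulSnd E G X Y - chartMulSnd E G Y X : E) := by
  set e := chartAt E (1 : G) with he
  let pull : GroupLieAlgebra 𝓘(ℝ, E) G → E → E := fun Z =>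
    VectorField.mpullbackWithin 𝓘(ℝ, E) 𝓘(ℝ, E) (extChartAt 𝓘(ℝ, E) (1 : G)).symm
        (mulInvariantVectorField Z) (Set.range 𝓘(ℝ, E))
  have hpull : ∀ Z : GroupLieAlgebra 𝓘(ℝ, E) G,
      pull Z =ᶠ[𝓝 (e 1)] fun x => chartLeft E G x Z := by
    intro Z
    filter_upwards [eventually_chartLeft_eq (E := E) (G := G),
      e.open_target.mem_nhds (mem_chart_target E (1 : G))] with x hx hxt
    have h1 : pull Z x =
        (tanMap E E e.symm x).inverse (tanMap E E (fun h : G => e.symm x * h) 1 Z) := by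
      change (mfderivWithin 𝓘(ℝ, E) 𝓘(ℝ, E) e.symm (Set.range 𝓘(ℝ, E)) x).inverse _ = _
      rw [ModelWithCorners.range_eq_univ, mfderivWithin_univ]
      rfl
    rw [h1, inverse_tanMap_chart_symm hxt, hx]
    rfl
  have hbr : (⁅X, Y⁆ : GroupLieAlgebra 𝓘(ℝ, E) G) = (tanMap E E e 1).inverse
      (VectorField.lieBracketWithin ℝ (pull X) (pull Y)
        ((extChartAt 𝓘(ℝ, E) (1 : G)).symm ⁻¹' Set.univ ∩ Set.range 𝓘(ℝ, E)) (e 1)) := rfl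
  rw [hbr, tanMap_chart_one, ContinuousLinearMap.inverse_id, ModelWithCorners.range_eq_univ,
    Set.preimage_univ, Set.inter_univ, VectorField.lieBracketWithin_univ]
  obtain ⟨S', hS, hS'⟩ := exists_hasFDerivAt_chartLeft (E := E) (G := G)
  have hd : ∀ Z : E, HasFDerivAt (fun x => chartLeft E G x Z) (S'.flip Z) (e 1) := fun Z =>
    ((ContinuousLinearMap.apply ℝ E Z).hasFDerivAt.comp (e 1) hS)
  change VectorField.lieBracket ℝ (pull X) (pull Y) (e 1) = _
  rw [(hpull X).lieBracket_vectorField_eq (hpull Y), VectorField.lieBracket, (hd X).fderiv,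
    (hd Y).fderiv, chartLeft_one]
  exact congrArg₂ (fun a b : E => a - b) (hS' X Y) (hS' Y X)

/-- The map `g ↦ Ad_{g⁻¹} X`, with values in the model space. -/
noncomputable def adInv (X : GroupLieAlgebra 𝓘(ℝ, E) G) (g : G) : E :=
  Ad 𝓘(ℝ, E) g⁻¹ X

/-- The map `g ↦ Ad_{g⁻¹} X` has differential `Y ↦ [X, Y]` at the identity. In the chart at `1` it
is the quotient of the differentials of the right and left translations. -/
theorem hasMFDerivAt_adInv [CompleteSpace E] (X : GroupLieAlgebra 𝓘(ℝ, E) G) :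
    MDifferentiableAt 𝓘(ℝ, E) 𝓘(ℝ, E) (adInv X : G → E) 1 ∧
    ∀ Y : GroupLieAlgebra 𝓘(ℝ, E) G,
      tanMap E E (adInv X) (1 : G) Y = (⁅X, Y⁆ : GroupLieAlgebra 𝓘(ℝ, E) G) := by
  set e := chartAt E (1 : G) with he
  obtain ⟨S', hS, hS'⟩ := exists_hasFDerivAt_chartLeft (E := E) (G := G)
  obtain ⟨W', hW, hW'⟩ := exists_hasFDerivAt_chartRight (E := E) (G := G)
  have hw : ∀ Z : E, HasFDerivAt (fun x => chartRight E G x Z) (W'.flip Z) (e 1) := fun Z =>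
    (ContinuousLinearMap.apply ℝ E Z).hasFDerivAt.comp (e 1) hW
  have hq' := hasFDerivAt_of_clm_apply_eq hS chartLeft_one (hw X) (B := fun x => adInv X (e.symm x))
    ((eventually_chartLeft_comp_Ad (E := E) (G := G)).mono fun x hx => hx X)
  have hmd : MDifferentiableAt 𝓘(ℝ, E) 𝓘(ℝ, E) (adInv X : G → E) 1 := by
    have h1 : MDifferentiableAt 𝓘(ℝ, E) 𝓘(ℝ, E) e (1 : G) :=
      mdifferentiableAt_atlas (chart_mem_atlas E _) (mem_chart_source E _)
    have h2 := hq'.differentiableAt.mdifferentiableAt.comp (1 : G) h1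
    refine h2.congr_of_eventuallyEq ?_
    filter_upwards [e.open_source.mem_nhds (mem_chart_source E _)] with g hg
    exact (congrArg (adInv X) (e.left_inv hg)).symm
  refine ⟨hmd, fun Y => ?_⟩
  rw [tanMap_eq_fderiv_chart hmd]
  have : fderiv ℝ (chartAt E (adInv X (1 : G)) ∘ adInv X ∘ e.symm) (e 1) = _ := hq'.fderiv
  rw [this, bracket_eq_chartMulSnd]
  have hr : chartRight E G (e 1) X = X := by rw [chartRight_one]; rfl
  rw [hr]
  exact congrArg₂ (fun a b : E => a - b) (hW' Y X) (hS' Y X)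

end AdjointDerivative

/-! ### The moment map of a homogeneous hamiltonian space -/

section Moment

variable {E : Type*} [NormedAddCommGroup E] [NormedSpace ℝ E]
  {G : Type*} [TopologicalSpace G] [ChartedSpace E G] [Group G]
  {F : Type*} [NormedAddCommGroup F] [NormedSpace ℝ F]
  {M : Type*} [TopologicalSpace M] [ChartedSpace F M] [IsManifold 𝓘(ℝ, F) ∞ M] [MulAction G M]
  {Ω : BilinField 𝓘(ℝ, F) M} {μ : M → LieDual 𝓘(ℝ, E) G}

/-- On fundamental vector fields, the symplectic form is given by the moment map: this is the
differential at the identity of the equivariance of `μ`. -/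
theorem IsHamiltonianSpace.form_fundamentalField [LieGroup 𝓘(ℝ, E) ∞ G] [FiniteDimensional ℝ E]
    (hM : IsHamiltonianSpace 𝓘(ℝ, E) 𝓘(ℝ, F) Ω μ) (X Y : GroupLieAlgebra 𝓘(ℝ, E) G) (p : M) :
    Ω p (fundamentalField 𝓘(ℝ, E) 𝓘(ℝ, F) X p) (fundamentalField 𝓘(ℝ, E) 𝓘(ℝ, F) Y p)
      = μ p ⁅X, Y⁆ := by
  have : CompleteSpace E := FiniteDimensional.complete ℝ E
  let l : E →L[ℝ] ℝ := LinearMap.toContinuousLinearMap (𝕜 := ℝ) (E := E) (μ p)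
  obtain ⟨hd, hder⟩ := hasMFDerivAt_adInv X
  have hl : MDifferentiableAt 𝓘(ℝ, E) 𝓘(ℝ, ℝ) l (adInv X (1 : G)) :=
    l.differentiableAt.mdifferentiableAt
  have h1 : tanMap E ℝ (l ∘ adInv X) (1 : G) Y = μ p ⁅X, Y⁆ := by
    rw [tanMap_comp hl hd, tanMap_eq_fderiv, l.fderiv]
    exact congrArg (μ p) (hder Y)
  have h2 : l ∘ adInv X = (fun q => μ q X) ∘ (fun g : G => g • p) := by
    funext g
    exact (LinearMap.congr_fun (hM.equivariant g p) X).symm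
  have h3 : ∀ q, (1 : G) • p = q → tanMap E ℝ ((fun q => μ q X) ∘ (fun g : G => g • p)) (1 : G) Y
      = tanMap F ℝ (fun q => μ q X) q (tanMap E F (fun g : G => g • p) 1 Y) := by
    rintro _ rfl
    rw [tanMap_comp ((hM.comoment_smooth X _).mdifferentiableAt (by simp))
      ((contMDiff_orbit hM.smooth_action p 1).mdifferentiableAt (by simp))]
    rfl
  rw [← h1, h2, h3 p (one_smul G p)]
  exact (hM.moment X p _).symm

theorem IsSymplecticForm.antisymm (hΩ : IsSymplecticForm Ω) (p : M) (v w : TangentSpace 𝓘(ℝ, F) p) :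
    Ω p v w = - Ω p w v := by
  have h := hΩ.alternating p (v + w)
  simp only [map_add, add_apply, hΩ.alternating p v, hΩ.alternating p w] at h
  linarith

/-- The values of `β ∈ 𝔤*` on finitely many elements of `𝔤`. -/
noncomputable def coords {n : ℕ} (X : Fin n → GroupLieAlgebra 𝓘(ℝ, E) G) (β : LieDual 𝓘(ℝ, E) G) :
    EuclideanSpace ℝ (Fin n) :=
  WithLp.toLp 2 fun i => β (X i)

theorem contMDiff_coords_comp {V : Type*} [NormedAddCommGroup V] [NormedSpace ℝ V]
    {N : Type*} [TopologicalSpace N] [ChartedSpace V N] {n : ℕ} {h : N → LieDual 𝓘(ℝ, E) G}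
    {s : Set N} (hh : ∀ X, ContMDiffOn 𝓘(ℝ, V) 𝓘(ℝ, ℝ) ∞ (fun q => h q X) s)
    (X : Fin n → GroupLieAlgebra 𝓘(ℝ, E) G) :
    ContMDiffOn 𝓘(ℝ, V) 𝓘(ℝ, EuclideanSpace ℝ (Fin n)) ∞ (fun q => coords X (h q)) s := by
  have h1 : ContMDiffOn 𝓘(ℝ, V) 𝓘(ℝ, Fin n → ℝ) ∞ (fun q i => h q (X i)) s :=
    contMDiffOn_pi_space.2 fun i => hh (X i)
  exact (EuclideanSpace.equiv (Fin n) ℝ).symm.contDiff.contMDiff.comp_contMDiffOn h1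

variable [LieGroup 𝓘(ℝ, E) ∞ G] [FiniteDimensional ℝ E] [FiniteDimensional ℝ F]
  [SecondCountableTopology G] [T2Space M]

theorem IsHamiltonianSpace.surjective_fundamentalField
    (hM : IsHamiltonianSpace 𝓘(ℝ, E) 𝓘(ℝ, F) Ω μ) (p : M) (v : TangentSpace 𝓘(ℝ, F) p) :
    ∃ X : GroupLieAlgebra 𝓘(ℝ, E) G, fundamentalField 𝓘(ℝ, E) 𝓘(ℝ, F) X p = v :=
  have := hM.homogeneous
  KKS.surjective_fundamentalField hM.smooth_action p v

/-- Near every point, suitable components of the moment map form a local coordinate system: the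
differential of `μ` at `p` is injective, because the symplectic form is nondegenerate and the
fundamental vector fields span the tangent space. -/
theorem IsHamiltonianSpace.exists_isLocalDiffeomorphAt
    (hM : IsHamiltonianSpace 𝓘(ℝ, E) 𝓘(ℝ, F) Ω μ) (p : M) :
    ∃ X : Fin (Module.finrank ℝ F) → GroupLieAlgebra 𝓘(ℝ, E) G,
      IsLocalDiffeomorphAt 𝓘(ℝ, F) 𝓘(ℝ, EuclideanSpace ℝ (Fin (Module.finrank ℝ F))) ∞
        (fun q => coords X (μ q)) p := by
  let b := Module.finBasis ℝ F
  choose X hX using fun i => hM.surjective_fundamentalField p (b i)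
  have hsm : ContMDiff 𝓘(ℝ, F) 𝓘(ℝ, EuclideanSpace ℝ (Fin (Module.finrank ℝ F))) ∞
      (fun q => coords X (μ q)) := by
    rw [← contMDiffOn_univ]
    exact contMDiff_coords_comp (fun X => (hM.comoment_smooth X).contMDiffOn) X
  have hd := (hsm p).mdifferentiableAt (by simp)
  refine ⟨X, isLocalDiffeomorphAt_of_bijective_tanMap hsm ?_⟩
  have hcomp : ∀ (v : F) i, tanMap F (EuclideanSpace ℝ (Fin (Module.finrank ℝ F)))
      (fun q => coords X (μ q)) p v i = Ω p (b i) v := by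
    intro v i
    let pr : EuclideanSpace ℝ (Fin (Module.finrank ℝ F)) →L[ℝ] ℝ := EuclideanSpace.proj i
    have h1 : tanMap F ℝ (pr ∘ fun q => coords X (μ q)) p v
        = pr (tanMap F (EuclideanSpace ℝ (Fin (Module.finrank ℝ F)))
          (fun q => coords X (μ q)) p v) := by
      rw [tanMap_comp pr.differentiableAt.mdifferentiableAt hd, tanMap_eq_fderiv, pr.fderiv]
      rfl
    refine h1.symm.trans ?_
    have h2 := hM.moment (X i) p v
    rw [hX i] at h2
    exact h2
  have hinj : Function.Injective
      (tanMap F (EuclideanSpace ℝ (Fin (Module.finrank ℝ F))) (fun q => coords X (μ q)) p) := by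
    rw [injective_iff_map_eq_zero]
    intro v hv
    refine hM.symplectic.nondegenerate p v fun w => ?_
    have hz : (Ω p v : F →L[ℝ] ℝ).toLinearMap = 0 := by
      refine b.ext fun i => ?_
      have h1 := hcomp v i
      rw [hv] at h1
      have h2 := hM.symplectic.antisymm p v (b i)
      rw [← h1] at h2
      exact h2.trans neg_zero
    exact LinearMap.congr_fun hz w
  refine ⟨hinj, ?_⟩
  exact (LinearMap.injective_iff_surjective_of_finrank_eq_finrank (by simp)).1 hinj

end Moment

/-! ### The orbit as a topological quotient, and the covering -/

section OrbitTopology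

variable {E : Type*} [NormedAddCommGroup E] [NormedSpace ℝ E]
  {G : Type*} [TopologicalSpace G] [ChartedSpace E G] [Group G]
  {F : Type*} [NormedAddCommGroup F] [NormedSpace ℝ F]
  {M : Type*} [TopologicalSpace M] [ChartedSpace F M] [IsManifold 𝓘(ℝ, F) ∞ M] [MulAction G M]
  {Ω : BilinField 𝓘(ℝ, F) M} {μ : M → LieDual 𝓘(ℝ, E) G}

theorem continuous_orbitMap (α : LieDual 𝓘(ℝ, E) G) : Continuous (CoadjointOrbit.orbitMap α) :=
  continuous_coinduced_rng

theorem surjective_orbitMap (α : LieDual 𝓘(ℝ, E) G) :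
    Function.Surjective (CoadjointOrbit.orbitMap α) := by
  rintro ⟨_, g, rfl⟩
  exact ⟨g, rfl⟩

theorem IsHamiltonianSpace.exists_coAd_eq (hM : IsHamiltonianSpace 𝓘(ℝ, E) 𝓘(ℝ, F) Ω μ) (p₀ p : M) :
    ∃ g : G, coAd 𝓘(ℝ, E) g (μ p₀) = μ p := by
  obtain ⟨g, rfl⟩ := hM.homogeneous.exists_smul_eq p₀ p
  exact ⟨g, (hM.equivariant g p₀).symm⟩

/-- The moment map, with codomain restricted to the coadjoint orbit of `μ p₀`. -/
def momentLift (hM : IsHamiltonianSpace 𝓘(ℝ, E) 𝓘(ℝ, F) Ω μ) (p₀ p : M) :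
    CoadjointOrbit 𝓘(ℝ, E) (μ p₀) :=
  ⟨μ p, hM.exists_coAd_eq p₀ p⟩

namespace IsHamiltonianSpace

variable (hM : IsHamiltonianSpace 𝓘(ℝ, E) 𝓘(ℝ, F) Ω μ) (p₀ : M)

theorem orbitMap_eq_momentLift (g : G) :
    CoadjointOrbit.orbitMap (μ p₀) g = momentLift hM p₀ (g • p₀) :=
  Subtype.ext (hM.equivariant g p₀).symm

theorem surjective_momentLift : Function.Surjective (momentLift hM p₀) := by
  intro β
  obtain ⟨g, rfl⟩ := surjective_orbitMap _ β
  exact ⟨g • p₀, (hM.orbitMap_eq_momentLift p₀ g).symm⟩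

end IsHamiltonianSpace

variable [LieGroup 𝓘(ℝ, E) ∞ G]

/-- The orbit map is open because right translations by the stabilizer are homeomorphisms. -/
theorem isOpenMap_orbitMap (α : LieDual 𝓘(ℝ, E) G) : IsOpenMap (CoadjointOrbit.orbitMap α) := by
  have := topologicalGroup_of_lieGroup 𝓘(ℝ, E) ∞ (G := G)
  intro U hU
  rw [isOpen_coinduced, isOpen_iff_mem_nhds]
  rintro g ⟨u, hu, hug⟩
  have hug' : coAd 𝓘(ℝ, E) u α = coAd 𝓘(ℝ, E) g α := congrArg Subtype.val hug
  have hcont : Continuous fun x : G => x * (u⁻¹ * g)⁻¹ := by fun_prop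
  -- right translation by the element `u⁻¹ * g` of the stabilizer does not change the orbit map
  filter_upwards [(hU.preimage hcont).mem_nhds (show g * (u⁻¹ * g)⁻¹ ∈ U by simpa using hu)]
    with x hx
  refine ⟨_, hx, Subtype.ext ?_⟩
  change coAd 𝓘(ℝ, E) (x * (u⁻¹ * g)⁻¹) α = coAd 𝓘(ℝ, E) x α
  have hstab : coAd 𝓘(ℝ, E) (u⁻¹ * g)⁻¹ α = α := by
    rw [mul_inv_rev, inv_inv, coAd_mul, hug', ← coAd_mul, inv_mul_cancel, coAd_one]
  rw [coAd_mul, hstab]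

namespace IsHamiltonianSpace

variable (hM : IsHamiltonianSpace 𝓘(ℝ, E) 𝓘(ℝ, F) Ω μ) (p₀ : M)

theorem momentLift_smul (g : G) (p : M) : momentLift hM p₀ (g • p) = g • momentLift hM p₀ p :=
  Subtype.ext (hM.equivariant g p)

theorem isOpenMap_momentLift : IsOpenMap (momentLift hM p₀) := by
  intro V hV
  have hπ := (contMDiff_orbit hM.smooth_action p₀).continuous
  convert isOpenMap_orbitMap (μ p₀) _ (hV.preimage hπ) using 1
  ext β
  constructor
  · rintro ⟨p, hp, rfl⟩
    obtain ⟨g, rfl⟩ := hM.homogeneous.exists_smul_eq p₀ p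
    exact ⟨g, hp, hM.orbitMap_eq_momentLift p₀ g⟩
  · rintro ⟨g, hg, rfl⟩
    exact ⟨g • p₀, hg, (hM.orbitMap_eq_momentLift p₀ g).symm⟩

variable [FiniteDimensional ℝ E] [FiniteDimensional ℝ F] [SecondCountableTopology G] [T2Space M]

/-- The orbit map of `M` is a quotient map, and `momentLift` composed with it is the orbit map of
the coadjoint orbit. -/
theorem continuous_momentLift : Continuous (momentLift hM p₀) := by
  have := hM.homogeneous
  have hq := (isOpenMap_orbit hM.smooth_action p₀).isQuotientMap
    (contMDiff_orbit hM.smooth_action p₀).continuous (hM.homogeneous.exists_smul_eq p₀)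
  rw [hq.continuous_iff]
  convert continuous_orbitMap (μ p₀)
  exact funext fun g => (hM.orbitMap_eq_momentLift p₀ g).symm

/-- Continuity of a function on the orbit can be tested on `M`. -/
theorem continuous_orbit_iff {Z : Type*} [TopologicalSpace Z]
    {h : CoadjointOrbit 𝓘(ℝ, E) (μ p₀) → Z} :
    Continuous h ↔ Continuous (h ∘ momentLift hM p₀) :=
  ((hM.isOpenMap_momentLift p₀).isQuotientMap (hM.continuous_momentLift p₀)
    (hM.surjective_momentLift p₀)).continuous_iff

/-- The values of `β` on `𝔤` are continuous functions of `β` which separate points. -/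
theorem t2Space_orbit (hM : IsHamiltonianSpace 𝓘(ℝ, E) 𝓘(ℝ, F) Ω μ) :
    T2Space (CoadjointOrbit 𝓘(ℝ, E) (μ p₀)) := by
  have hcont : ∀ X : GroupLieAlgebra 𝓘(ℝ, E) G,
      Continuous fun β : CoadjointOrbit 𝓘(ℝ, E) (μ p₀) => β.incl X := fun X =>
    (hM.continuous_orbit_iff p₀).2 (hM.comoment_smooth X).continuous
  refine T2Space.of_injective_continuous
    (f := fun (β : CoadjointOrbit 𝓘(ℝ, E) (μ p₀)) (X : GroupLieAlgebra 𝓘(ℝ, E) G) => β.incl X)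
    (fun β γ h => Subtype.ext (LinearMap.ext fun X => congrFun h X)) (continuous_pi hcont)

/-- Around `p`, the moment map to the orbit is a homeomorphism `e` onto an open set, and some
components `coords X` of `μ` form a smooth coordinate system `Φ` with the same domain. -/
theorem exists_local_coordinates (p : M) :
    ∃ (X : Fin (Module.finrank ℝ F) → GroupLieAlgebra 𝓘(ℝ, E) G)
      (Φ : PartialDiffeomorph 𝓘(ℝ, F) 𝓘(ℝ, EuclideanSpace ℝ (Fin (Module.finrank ℝ F))) M
        (EuclideanSpace ℝ (Fin (Module.finrank ℝ F))) ∞)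
      (e : OpenPartialHomeomorph M (CoadjointOrbit 𝓘(ℝ, E) (μ p₀))),
      p ∈ Φ.source ∧ Set.EqOn (fun q => coords X (μ q)) Φ Φ.source ∧ e.source = Φ.source ∧
        ∀ q, e q = momentLift hM p₀ q := by
  obtain ⟨X, Φ, hp, hΦ⟩ := hM.exists_isLocalDiffeomorphAt p
  have hinj : Set.InjOn (momentLift hM p₀) Φ.source := by
    intro x hx y hy hxy
    refine Φ.injOn hx hy ?_
    have h1 := hΦ hx
    have h2 := hΦ hy
    have h3 : μ x = μ y := congrArg Subtype.val hxy
    simp only [h3] at h1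
    exact h1.symm.trans h2
  have : Nonempty M := ⟨p⟩
  refine ⟨X, Φ, OpenPartialHomeomorph.ofContinuousOpen (hinj.bijOn_image.toPartialEquiv)
    (hM.continuous_momentLift p₀).continuousOn (hM.isOpenMap_momentLift p₀) Φ.open_source,
    hp, hΦ, rfl, fun q => rfl⟩

theorem isLocalHomeomorph_momentLift : IsLocalHomeomorph (momentLift hM p₀) := by
  intro p
  obtain ⟨X, Φ, e, hp, -, hes, he⟩ := hM.exists_local_coordinates p₀ p
  exact ⟨e, hes ▸ hp, funext fun q => (he q).symm⟩

/-- The orbit map `g ↦ g • momentLift p` has a continuous local section near `momentLift p`. -/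
theorem exists_local_section_orbit (p : M) :
    ∃ s : CoadjointOrbit 𝓘(ℝ, E) (μ p₀) → G, ∀ᶠ β in 𝓝 (momentLift hM p₀ p),
      s β • momentLift hM p₀ p = β ∧ ContinuousAt s β := by
  have := hM.homogeneous
  obtain ⟨s, -, hs⟩ := exists_local_section_of_surjective_tanMap
    (contMDiff_orbit hM.smooth_action p) (surjective_tanMap_orbit hM.smooth_action p 1)
  simp only [one_smul] at hs
  obtain ⟨e, hpe, he⟩ := hM.isLocalHomeomorph_momentLift p₀ p
  have hep : momentLift hM p₀ p ∈ e.target := by rw [he]; exact e.map_source hpe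
  have hsymm : e.symm (momentLift hM p₀ p) = p := by rw [he]; exact e.left_inv hpe
  refine ⟨fun β => s (e.symm β), ?_⟩
  have h1 : ∀ᶠ β in 𝓝 (momentLift hM p₀ p), s (e.symm β) • p = e.symm β ∧
      ContinuousAt s (e.symm β) := by
    have h2 := e.continuousAt_symm hep
    rw [ContinuousAt, hsymm] at h2
    exact h2.eventually hs
  filter_upwards [h1, e.open_target.mem_nhds hep] with β hβ hβt
  refine ⟨?_, ContinuousAt.comp (g := s) hβ.2 (e.continuousAt_symm hβt)⟩
  rw [← hM.momentLift_smul, hβ.1, he]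
  exact e.right_inv hβt

/-- The moment map is a covering of the orbit: over an open set `W ∋ β₀` on which the orbit map has
a section `s`, the map `(w, x) ↦ s w • x` trivializes it. -/
theorem isCoveringMap_momentLift : IsCoveringMap (momentLift hM p₀) := by
  have := topologicalGroup_of_lieGroup 𝓘(ℝ, E) ∞ (G := G)
  have : ContinuousSMul G M := ⟨hM.smooth_action.contMDiff_smul.continuous⟩
  intro β₀
  set f := momentLift hM p₀
  have hfs : ∀ (g : G) (p : M), f (g • p) = g • f p := hM.momentLift_smul p₀
  have hfc : Continuous f := hM.continuous_momentLift p₀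
  obtain ⟨p, hp⟩ := hM.surjective_momentLift p₀ β₀
  obtain ⟨s, hs⟩ := hM.exists_local_section_orbit p₀ p
  obtain ⟨W, hW, hWo, hpW⟩ := eventually_nhds_iff.1 hs
  rw [hp] at hW hpW
  have hsc : Continuous fun w : W => s w :=
    continuous_iff_continuousAt.2 fun w => (hW w w.2).2.comp continuous_subtype_val.continuousAt
  refine ⟨?_, W, hpW, hWo, hWo.preimage hfc, ?_⟩
  · have : Subsingleton (f '' (f ⁻¹' {β₀})) :=
      Set.subsingleton_coe _ |>.2 (Set.subsingleton_singleton.anti (Set.image_preimage_subset _ _))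
    exact (hM.isLocalHomeomorph_momentLift p₀).isLocalHomeomorphOn.discreteTopology_of_image
      (s := f ⁻¹' {β₀})
  refine ⟨{ toFun := fun q => (⟨f q, q.2⟩, ⟨(s (f q))⁻¹ • (q : M), ?_⟩)
            invFun := fun z => ⟨s z.1 • (z.2 : M), ?_⟩
            left_inv := ?_
            right_inv := ?_
            continuous_toFun := ?_
            continuous_invFun := ?_ }, fun q => rfl⟩
  · change f ((s (f q))⁻¹ • (q : M)) = β₀
    rw [hfs, inv_smul_eq_iff]
    exact (hW _ q.2).1.symm
  · have hz : f z.2 = β₀ := z.2.2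
    change f (s z.1 • (z.2 : M)) ∈ W
    rw [hfs, hz, (hW _ z.1.2).1]
    exact z.1.2
  · intro q
    simp
  · rintro ⟨w, x⟩
    have hx : f x = β₀ := x.2
    have h1 : f (s w • (x : M)) = w := by
      rw [hfs, hx, (hW _ w.2).1]
    refine Prod.ext (Subtype.ext h1) (Subtype.ext ?_)
    simp [h1]
  · have h1 : Continuous fun q : f ⁻¹' W => s (f q) :=
      hsc.comp (f := fun q : f ⁻¹' W => (⟨f q, q.2⟩ : W)) (by fun_prop)
    exact (Continuous.subtype_mk (by fun_prop) _).prodMk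
      (Continuous.subtype_mk (h1.inv.smul continuous_subtype_val) _)
  · have h1 : Continuous fun z : W × (f ⁻¹' {β₀}) => s z.1 := hsc.comp continuous_fst
    exact Continuous.subtype_mk (h1.smul (continuous_subtype_val.comp continuous_snd)) _

end IsHamiltonianSpace
end OrbitTopology

/-! ### The smooth structure of the orbit -/

section OrbitManifold

variable {E : Type*} [NormedAddCommGroup E] [NormedSpace ℝ E]
  {G : Type*} [TopologicalSpace G] [ChartedSpace E G] [Group G]
  {V : Type*} [NormedAddCommGroup V] [NormedSpace ℝ V]
  {N : Type*} [TopologicalSpace N] [ChartedSpace V N]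
  (n : ℕ)

/-- The charts of the coadjoint orbit are given by values of `β` on elements of `𝔤`, and the
inclusion in `𝔤*` is smooth when read in them. -/
structure HasComponentCharts (α : LieDual 𝓘(ℝ, E) G)
    [ChartedSpace (EuclideanSpace ℝ (Fin n)) (CoadjointOrbit 𝓘(ℝ, E) α)] : Prop where
  eq_coords : ∀ c ∈ atlas (EuclideanSpace ℝ (Fin n)) (CoadjointOrbit 𝓘(ℝ, E) α),
    ∃ X : Fin n → GroupLieAlgebra 𝓘(ℝ, E) G, ∀ γ ∈ c.source, c γ = coords X γ.incl
  smooth_symm : ∀ c ∈ atlas (EuclideanSpace ℝ (Fin n)) (CoadjointOrbit 𝓘(ℝ, E) α),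
    ∀ Z : GroupLieAlgebra 𝓘(ℝ, E) G,
      ContMDiffOn 𝓘(ℝ, EuclideanSpace ℝ (Fin n)) 𝓘(ℝ, ℝ) ∞ (fun y => (c.symm y).incl Z) c.target

namespace HasComponentCharts

variable {n} {α : LieDual 𝓘(ℝ, E) G}
  [ChartedSpace (EuclideanSpace ℝ (Fin n)) (CoadjointOrbit 𝓘(ℝ, E) α)]

theorem isManifold (hC : HasComponentCharts n α) :
    IsManifold (𝓡 n) ∞ (CoadjointOrbit 𝓘(ℝ, E) α) := by
  refine isManifold_of_contDiffOn (𝓡 n) ∞ _ fun c c' hc hc' => ?_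
  obtain ⟨X, hX⟩ := hC.eq_coords c' hc'
  have h1 := contMDiff_coords_comp (h := fun y => (c.symm y).incl) (hC.smooth_symm c hc) X
  rw [contMDiffOn_iff_contDiffOn] at h1
  refine (h1.mono ?_).congr ?_
  · rintro y ⟨hy, -⟩
    exact hy.1
  · rintro y ⟨hy, -⟩
    exact hX _ hy.2

/-- A continuous map to the orbit is smooth if its components are. -/
theorem contMDiff_of_components (hC : HasComponentCharts n α) {h : N → CoadjointOrbit 𝓘(ℝ, E) α}
    (hc : Continuous h) (hh : ∀ X, ContMDiff 𝓘(ℝ, V) 𝓘(ℝ, ℝ) ∞ (fun q => (h q).incl X)) :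
    ContMDiff 𝓘(ℝ, V) (𝓡 n) ∞ h := by
  intro x
  obtain ⟨X, hX⟩ := hC.eq_coords _ (chart_mem_atlas (EuclideanSpace ℝ (Fin n)) (h x))
  refine contMDiffAt_iff_target.2 ⟨hc.continuousAt, ?_⟩
  have h1 := contMDiff_coords_comp (s := Set.univ) (fun X => (hh X).contMDiffOn) X
  refine (h1.contMDiffAt Filter.univ_mem).congr_of_eventuallyEq ?_
  filter_upwards [hc.continuousAt.eventually_mem
    ((chartAt (EuclideanSpace ℝ (Fin n)) (h x)).open_source.mem_nhds (mem_chart_source _ _))]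
    with q hq
  exact hX _ hq

theorem contMDiff_incl (hC : HasComponentCharts n α) (Z : GroupLieAlgebra 𝓘(ℝ, E) G) :
    ContMDiff (𝓡 n) 𝓘(ℝ, ℝ) ∞ (fun β : CoadjointOrbit 𝓘(ℝ, E) α => β.incl Z) := by
  have := hC.isManifold
  intro β
  set c := chartAt (EuclideanSpace ℝ (Fin n)) β
  have hβ : β ∈ c.source := mem_chart_source _ _
  have h1 : ContMDiffAt (𝓡 n) (𝓡 n) ∞ c β :=
    (contMDiffOn_chart (I := 𝓡 n) (n := ∞) (x := β)).contMDiffAt (c.open_source.mem_nhds hβ)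
  have h2 := (hC.smooth_symm c (chart_mem_atlas _ _) Z).contMDiffAt
    (c.open_target.mem_nhds (c.map_source hβ))
  refine (h2.comp β h1).congr_of_eventuallyEq ?_
  filter_upwards [c.open_source.mem_nhds hβ] with γ hγ
  simp [c.left_inv hγ]

end HasComponentCharts

variable {F : Type*} [NormedAddCommGroup F] [NormedSpace ℝ F]
  {M : Type*} [TopologicalSpace M] [ChartedSpace F M] [IsManifold 𝓘(ℝ, F) ∞ M] [MulAction G M]
  {Ω : BilinField 𝓘(ℝ, F) M} {μ : M → LieDual 𝓘(ℝ, E) G}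
  [LieGroup 𝓘(ℝ, E) ∞ G] [FiniteDimensional ℝ E] [FiniteDimensional ℝ F]
  [SecondCountableTopology G] [T2Space M]

namespace IsHamiltonianSpace

/-- The charts are those of `exists_local_coordinates`, carried to the orbit by the moment map. -/
theorem exists_hasComponentCharts (hM : IsHamiltonianSpace 𝓘(ℝ, E) 𝓘(ℝ, F) Ω μ) (p₀ : M) :
    ∃ _ : ChartedSpace (EuclideanSpace ℝ (Fin (Module.finrank ℝ F)))
        (CoadjointOrbit 𝓘(ℝ, E) (μ p₀)),
      HasComponentCharts (Module.finrank ℝ F) (μ p₀) := by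
  have key : ∀ β : CoadjointOrbit 𝓘(ℝ, E) (μ p₀), ∃ c : OpenPartialHomeomorph
      (CoadjointOrbit 𝓘(ℝ, E) (μ p₀)) (EuclideanSpace ℝ (Fin (Module.finrank ℝ F))),
      β ∈ c.source ∧
      (∃ X : Fin (Module.finrank ℝ F) → GroupLieAlgebra 𝓘(ℝ, E) G,
        ∀ γ ∈ c.source, c γ = coords X γ.incl) ∧
      ∀ Z : GroupLieAlgebra 𝓘(ℝ, E) G,
        ContMDiffOn 𝓘(ℝ, EuclideanSpace ℝ (Fin (Module.finrank ℝ F))) 𝓘(ℝ, ℝ) ∞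
          (fun y => (c.symm y).incl Z) c.target := by
    intro β
    obtain ⟨p, rfl⟩ := hM.surjective_momentLift p₀ β
    obtain ⟨X, Φ, e, hp, hΦ, hes, he⟩ := hM.exists_local_coordinates p₀ p
    refine ⟨e.symm.trans Φ.toOpenPartialHomeomorph, ?_, ⟨X, ?_⟩, ?_⟩
    · have hpe : p ∈ e.source := hes ▸ hp
      rw [← he p]
      refine ⟨e.map_source hpe, ?_⟩
      change e.symm (e p) ∈ Φ.source
      rwa [e.left_inv hpe]
    · intro γ hγ
      have h1 : e.symm γ ∈ Φ.source := hγ.2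
      have h2 : momentLift hM p₀ (e.symm γ) = γ := by
        rw [← he]
        exact e.right_inv hγ.1
      have h3 : μ (e.symm γ) = γ.incl := congrArg Subtype.val h2
      change Φ (e.symm γ) = _
      rw [← h3]
      exact (hΦ h1).symm
    · intro Z
      have h1 := (hM.comoment_smooth Z).comp_contMDiffOn Φ.contMDiffOn_invFun
      refine (h1.mono fun y hy => hy.1).congr fun y hy => ?_
      have h2 : e (Φ.symm y) = momentLift hM p₀ (Φ.symm y) := he _
      exact LinearMap.congr_fun (congrArg Subtype.val h2) Z
  choose c hc1 hc2 hc3 using key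
  let C : ChartedSpace (EuclideanSpace ℝ (Fin (Module.finrank ℝ F)))
      (CoadjointOrbit 𝓘(ℝ, E) (μ p₀)) :=
    { atlas := Set.range c
      chartAt := c
      mem_chart_source := hc1
      chart_mem_atlas := fun β => ⟨β, rfl⟩ }
  refine ⟨C, ⟨?_, ?_⟩⟩
  · rintro _ ⟨β, rfl⟩
    exact hc2 β
  · rintro _ ⟨β, rfl⟩
    exact hc3 β

variable (hM : IsHamiltonianSpace 𝓘(ℝ, E) 𝓘(ℝ, F) Ω μ) (p₀ : M)
  [ChartedSpace (EuclideanSpace ℝ (Fin (Module.finrank ℝ F))) (CoadjointOrbit 𝓘(ℝ, E) (μ p₀))]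

/-- Near `p` the local inverse of `momentLift` is `Φ.symm ∘ coords X`, where `coords X ∘ μ = Φ` is a
local coordinate system of `M`. -/
theorem isLocalDiffeomorph_momentLift
    (hC : HasComponentCharts (Module.finrank ℝ F) (μ p₀)) :
    IsLocalDiffeomorph 𝓘(ℝ, F) (𝓡 (Module.finrank ℝ F)) ∞ (momentLift hM p₀) := by
  intro p
  obtain ⟨X, Φ, e, hp, hΦ, hes, he⟩ := hM.exists_local_coordinates p₀ p
  have hf := hC.contMDiff_of_components (hM.continuous_momentLift p₀) hM.comoment_smooth
  refine ⟨{ toPartialEquiv := e.toPartialEquiv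
            open_source := e.open_source
            open_target := e.open_target
            contMDiffOn_toFun := hf.contMDiffOn.congr fun q _ => he q
            contMDiffOn_invFun := ?_ }, hes ▸ hp, fun q _ => (he q).symm⟩
  have h1 := contMDiff_coords_comp (s := e.target) (fun Z => (hC.contMDiff_incl Z).contMDiffOn) X
  have key : ∀ β ∈ e.target, Φ (e.symm β) = coords X β.incl ∧ e.symm β ∈ Φ.source := by
    intro β hβ
    have hs : e.symm β ∈ Φ.source := hes ▸ e.map_target hβ
    have h2 : momentLift hM p₀ (e.symm β) = β := by
      rw [← he]
      exact e.right_inv hβ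
    have h3 : μ (e.symm β) = β.incl := congrArg Subtype.val h2
    rw [← h3]
    exact ⟨(hΦ hs).symm, hs⟩
  refine (Φ.contMDiffOn_invFun.comp h1 ?_).congr ?_
  · intro β hβ
    change coords X β.incl ∈ Φ.target
    rw [← (key β hβ).1]
    exact Φ.map_source (key β hβ).2
  · intro β hβ
    change e.symm β = Φ.symm (coords X β.incl)
    rw [← (key β hβ).1]
    exact (Φ.left_inv (key β hβ).2).symm

end IsHamiltonianSpace

end OrbitManifold

/-! ### Pushing a symplectic form forward along a local diffeomorphism -/

section Forms

variable {F : Type*} [NormedAddCommGroup F] [NormedSpace ℝ F]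
  {M : Type*} [TopologicalSpace M] [ChartedSpace F M] [IsManifold 𝓘(ℝ, F) ∞ M]
  {W : Type*} [NormedAddCommGroup W] [NormedSpace ℝ W] [FiniteDimensional ℝ W]
  {N : Type*} [TopologicalSpace N] [ChartedSpace W N]
  {Z : Type*} [NormedAddCommGroup Z] [NormedSpace ℝ Z]

/-- A family of linear maps on a finite-dimensional space is smooth if its values are. -/
theorem contMDiffAt_clm_of_apply {f : N → W →L[ℝ] Z} {x : N}
    (h : ∀ w, ContMDiffAt 𝓘(ℝ, W) 𝓘(ℝ, Z) ∞ (fun q => f q w) x) :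
    ContMDiffAt 𝓘(ℝ, W) 𝓘(ℝ, W →L[ℝ] Z) ∞ f x := by
  have hd : Module.finrank ℝ W = Module.finrank ℝ (Fin (Module.finrank ℝ W) → ℝ) :=
    (Module.finrank_fin_fun ℝ).symm
  -- `W →L[ℝ] Z` is a finite power of `Z`
  let e₁ := ContinuousLinearEquiv.ofFinrankEq hd
  let e₂ := (e₁.arrowCongr (1 : Z ≃L[ℝ] Z)).trans
    (ContinuousLinearEquiv.piRing (Fin (Module.finrank ℝ W)))
  rw [← Function.id_comp f, ← e₂.symm_comp_self]
  refine e₂.symm.contDiff.contMDiff.contMDiffAt.comp x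
    (I' := 𝓘(ℝ, Fin (Module.finrank ℝ W) → Z)) ?_
  exact contMDiffAt_pi_space.2 fun i => h _

/-- A field of bilinear forms is smooth if its values on smooth vector fields are. -/
theorem contMDiffAt_bilinField [IsManifold 𝓘(ℝ, W) ∞ N] {σ : BilinField 𝓘(ℝ, W) N} {x : N}
    (h : ∀ U V : ∀ q : N, TangentSpace 𝓘(ℝ, W) q,
      ContMDiffAt 𝓘(ℝ, W) 𝓘(ℝ, W).tangent ∞ (fun q => (⟨q, U q⟩ : TangentBundle 𝓘(ℝ, W) N)) x →
      ContMDiffAt 𝓘(ℝ, W) 𝓘(ℝ, W).tangent ∞ (fun q => (⟨q, V q⟩ : TangentBundle 𝓘(ℝ, W) N)) x →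
      ContMDiffAt 𝓘(ℝ, W) 𝓘(ℝ, ℝ) ∞ (fun q => σ q (U q) (V q)) x) :
    ContMDiffAt 𝓘(ℝ, W) (𝓘(ℝ, W).prod 𝓘(ℝ, W →L[ℝ] W →L[ℝ] ℝ)) ∞
      (fun p => Bundle.TotalSpace.mk' (W →L[ℝ] W →L[ℝ] ℝ)
        (E := fun q : N => TangentSpace 𝓘(ℝ, W) q →L[ℝ] TangentSpace 𝓘(ℝ, W) q →L[ℝ] ℝ)
        p (σ p)) x := by
  rw [Bundle.contMDiffAt_section]
  refine contMDiffAt_clm_of_apply fun v => contMDiffAt_clm_of_apply fun w => ?_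
  let e := trivializationAt W (TangentSpace 𝓘(ℝ, W) : N → Type _) x
  have hx : x ∈ e.baseSet := FiberBundle.mem_baseSet_trivializationAt' x
  have hconst : ∀ u : W, ContMDiffAt 𝓘(ℝ, W) 𝓘(ℝ, W).tangent ∞
      (fun q => (⟨q, e.symm q u⟩ : TangentBundle 𝓘(ℝ, W) N)) x := by
    intro u
    refine (e.contMDiffAt_section_iff hx).2 ?_
    refine (contMDiffAt_const (c := u)).congr_of_eventuallyEq ?_
    filter_upwards [e.open_baseSet.mem_nhds hx] with q hq
    simp [e.apply_mk_symm hq u]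
  refine (h _ _ (hconst v) (hconst w)).congr_of_eventuallyEq ?_
  filter_upwards [e.open_baseSet.mem_nhds hx] with q hq
  have h1 := inCoordinates_apply_eq₂ (F₁ := W) (F₂ := W) (F₃ := ℝ)
    (E₁ := fun q : N => TangentSpace 𝓘(ℝ, W) q) (E₂ := fun q : N => TangentSpace 𝓘(ℝ, W) q)
    (E₃ := Bundle.Trivial N ℝ) (x₀ := x) (x := q) (ϕ := σ q) (v := v) (w := w) hq hq
    (Set.mem_univ q)
  exact h1.trans (DFunLike.congr_fun (Bundle.Trivial.linearMapAt_trivialization ℝ N ℝ q) _)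

theorem IsSymplecticForm.contMDiffAt_apply {Ω : BilinField 𝓘(ℝ, F) M} (hΩ : IsSymplecticForm Ω)
    {U V : ∀ q : M, TangentSpace 𝓘(ℝ, F) q} {p : M}
    (hU : ContMDiffAt 𝓘(ℝ, F) 𝓘(ℝ, F).tangent ∞ (fun q => (⟨q, U q⟩ : TangentBundle 𝓘(ℝ, F) M)) p)
    (hV : ContMDiffAt 𝓘(ℝ, F) 𝓘(ℝ, F).tangent ∞
      (fun q => (⟨q, V q⟩ : TangentBundle 𝓘(ℝ, F) M)) p) :
    ContMDiffAt 𝓘(ℝ, F) 𝓘(ℝ, ℝ) ∞ (fun q => Ω q (U q) (V q)) p := by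
  have : ContMDiffAt 𝓘(ℝ, F) (𝓘(ℝ, F).prod 𝓘(ℝ)) ∞
      (fun m ↦ Bundle.TotalSpace.mk' ℝ (E := Bundle.Trivial M ℝ) m (Ω m (U m) (V m))) p := by
    apply ContMDiffAt.clm_bundle_apply₂ (F₁ := F) (F₂ := F)
    · exact hΩ.smooth p
    · exact hU
    · exact hV
  simp only [Bundle.contMDiffAt_totalSpace] at this
  exact this.2

end Forms

section Pushforward

variable {F : Type*} [NormedAddCommGroup F] [NormedSpace ℝ F]
  {M : Type*} [TopologicalSpace M] [ChartedSpace F M]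
  {W : Type*} [NormedAddCommGroup W] [NormedSpace ℝ W]
  {N : Type*} [TopologicalSpace N] [ChartedSpace W N]
  {f : M → N}

theorem isInvertible_mfderiv (hf : IsLocalDiffeomorph 𝓘(ℝ, F) 𝓘(ℝ, W) ∞ f) (p : M) :
    (mfderiv 𝓘(ℝ, F) 𝓘(ℝ, W) f p).IsInvertible :=
  ⟨hf.mfderivToContinuousLinearEquiv (by simp) p, rfl⟩

/-- `f^* σ = Ω`. -/
def IsPullback (f : M → N) (Ω : BilinField 𝓘(ℝ, F) M) (σ : BilinField 𝓘(ℝ, W) N) : Prop :=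
  ∀ (p : M) (v w : TangentSpace 𝓘(ℝ, F) p),
    σ (f p) (mfderiv 𝓘(ℝ, F) 𝓘(ℝ, W) f p v) (mfderiv 𝓘(ℝ, F) 𝓘(ℝ, W) f p w) = Ω p v w

namespace IsPullback

variable {Ω : BilinField 𝓘(ℝ, F) M} {σ : BilinField 𝓘(ℝ, W) N}

/-- `σ (U, V)` is, on `M`, the value of `Ω` on the pullbacks of the vector fields. -/
theorem apply_mpullback (hσ : IsPullback f Ω σ) (hf : IsLocalDiffeomorph 𝓘(ℝ, F) 𝓘(ℝ, W) ∞ f)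
    (U V : ∀ q : N, TangentSpace 𝓘(ℝ, W) q) (p : M) :
    Ω p (VectorField.mpullback 𝓘(ℝ, F) 𝓘(ℝ, W) f U p) (VectorField.mpullback 𝓘(ℝ, F) 𝓘(ℝ, W) f V p)
      = σ (f p) (U (f p)) (V (f p)) := by
  rw [← hσ p, VectorField.mpullback_apply, VectorField.mpullback_apply,
    (isInvertible_mfderiv hf p).self_apply_inverse, (isInvertible_mfderiv hf p).self_apply_inverse]

/-- Together with `apply_mlieBracket`, this says that each term of `dσ` on vector fields `U`, `V`,
`X` is the corresponding term of `dΩ` on their pullbacks. -/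
theorem dirDeriv_eq (hσ : IsPullback f Ω σ)
    (hf : IsLocalDiffeomorph 𝓘(ℝ, F) 𝓘(ℝ, W) ∞ f)
    {V X : ∀ q : N, TangentSpace 𝓘(ℝ, W) q} {p : M}
    (h : ContMDiffAt 𝓘(ℝ, W) 𝓘(ℝ, ℝ) ∞ (fun q => σ q (V q) (X q)) (f p))
    (U : ∀ q : N, TangentSpace 𝓘(ℝ, W) q) :
    dirDeriv (I := 𝓘(ℝ, F)) (fun q => Ω q (VectorField.mpullback 𝓘(ℝ, F) 𝓘(ℝ, W) f V q)
        (VectorField.mpullback 𝓘(ℝ, F) 𝓘(ℝ, W) f X q)) p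
        (VectorField.mpullback 𝓘(ℝ, F) 𝓘(ℝ, W) f U p)
      = dirDeriv (I := 𝓘(ℝ, W)) (fun q => σ q (V q) (X q)) (f p) (U (f p)) := by
  have h1 : (fun q => Ω q (VectorField.mpullback 𝓘(ℝ, F) 𝓘(ℝ, W) f V q)
        (VectorField.mpullback 𝓘(ℝ, F) 𝓘(ℝ, W) f X q)) = (fun q => σ q (V q) (X q)) ∘ f :=
    funext fun q => hσ.apply_mpullback hf V X q
  have h2 := tanMap_comp (h.mdifferentiableAt (by simp)) ((hf p).mdifferentiableAt (by simp))
  have h3 : tanMap F W f p (VectorField.mpullback 𝓘(ℝ, F) 𝓘(ℝ, W) f U p) = U (f p) :=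
    (isInvertible_mfderiv hf p).self_apply_inverse _
  rw [h1]
  refine (DFunLike.congr_fun h2 _).trans ?_
  exact congrArg (tanMap W ℝ (fun q => σ q (V q) (X q)) (f p)) h3

variable [IsManifold 𝓘(ℝ, F) ∞ M] [IsManifold 𝓘(ℝ, W) ∞ N] [CompleteSpace F]

theorem contMDiffAt_apply (hσ : IsPullback f Ω σ)
    (hf : IsLocalDiffeomorph 𝓘(ℝ, F) 𝓘(ℝ, W) ∞ f) (hΩ : IsSymplecticForm Ω)
    {U V : ∀ q : N, TangentSpace 𝓘(ℝ, W) q} {p : M}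
    (hU : ContMDiffAt 𝓘(ℝ, W) 𝓘(ℝ, W).tangent ∞
      (fun q => (⟨q, U q⟩ : TangentBundle 𝓘(ℝ, W) N)) (f p))
    (hV : ContMDiffAt 𝓘(ℝ, W) 𝓘(ℝ, W).tangent ∞
      (fun q => (⟨q, V q⟩ : TangentBundle 𝓘(ℝ, W) N)) (f p)) :
    ContMDiffAt 𝓘(ℝ, W) 𝓘(ℝ, ℝ) ∞ (fun q => σ q (U q) (V q)) (f p) := by
  have h1 := hΩ.contMDiffAt_apply
    (hU.mpullback_vectorField_preimage (hf p).contMDiffAt (isInvertible_mfderiv hf p) (by simp))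
    (hV.mpullback_vectorField_preimage (hf p).contMDiffAt (isInvertible_mfderiv hf p) (by simp))
  have hp : (hf p).localInverse (f p) = p :=
    (hf p).localInverse_left_inv (hf p).localInverse_mem_target
  rw [← hp] at h1
  refine (h1.comp (f p) (hf p).localInverse_contMDiffAt).congr_of_eventuallyEq ?_
  filter_upwards [(hf p).localInverse_eventuallyEq_right] with q hq
  change f ((hf p).localInverse q) = q at hq
  change _ = Ω _ _ _
  rw [hσ.apply_mpullback hf, hq]

theorem apply_mlieBracket (hσ : IsPullback f Ω σ)
    (hf : IsLocalDiffeomorph 𝓘(ℝ, F) 𝓘(ℝ, W) ∞ f)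
    {U V : ∀ q : N, TangentSpace 𝓘(ℝ, W) q} {p : M}
    (hU : ContMDiffAt 𝓘(ℝ, W) 𝓘(ℝ, W).tangent ∞
      (fun q => (⟨q, U q⟩ : TangentBundle 𝓘(ℝ, W) N)) (f p))
    (hV : ContMDiffAt 𝓘(ℝ, W) 𝓘(ℝ, W).tangent ∞
      (fun q => (⟨q, V q⟩ : TangentBundle 𝓘(ℝ, W) N)) (f p))
    (X : ∀ q : N, TangentSpace 𝓘(ℝ, W) q) :
    Ω p (VectorField.mlieBracket 𝓘(ℝ, F) (VectorField.mpullback 𝓘(ℝ, F) 𝓘(ℝ, W) f U)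
        (VectorField.mpullback 𝓘(ℝ, F) 𝓘(ℝ, W) f V) p)
        (VectorField.mpullback 𝓘(ℝ, F) 𝓘(ℝ, W) f X p)
      = σ (f p) (VectorField.mlieBracket 𝓘(ℝ, W) U V (f p)) (X (f p)) := by
  have two_le : (2 : ℕ∞ω) ≤ ∞ := ENat.LEInfty.out
  have : IsManifold 𝓘(ℝ, F) (minSmoothness ℝ 2) M := by
    rw [minSmoothness_of_isRCLikeNormedField]; exact IsManifold.of_le (n := ∞) two_le
  have : IsManifold 𝓘(ℝ, W) (minSmoothness ℝ 2) N := by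
    rw [minSmoothness_of_isRCLikeNormedField]; exact IsManifold.of_le (n := ∞) two_le
  rw [← VectorField.mpullback_mlieBracket (hU.mdifferentiableAt (by simp))
    (hV.mdifferentiableAt (by simp)) (hf p).contMDiffAt
    (by rw [minSmoothness_of_isRCLikeNormedField]; exact two_le)]
  exact hσ.apply_mpullback hf _ _ p

/-- A form whose pullback along a surjective local diffeomorphism is symplectic is symplectic. -/
theorem isSymplecticForm [FiniteDimensional ℝ W] (hσ : IsPullback f Ω σ)
    (hf : IsLocalDiffeomorph 𝓘(ℝ, F) 𝓘(ℝ, W) ∞ f) (hsurj : Function.Surjective f)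
    (hΩ : IsSymplecticForm Ω) : IsSymplecticForm σ where
  smooth := by
    intro q
    obtain ⟨p, rfl⟩ := hsurj q
    exact contMDiffAt_bilinField fun U V hU hV => hσ.contMDiffAt_apply hf hΩ hU hV
  alternating := by
    intro q v
    obtain ⟨p, rfl⟩ := hsurj q
    obtain ⟨v, rfl⟩ := (isInvertible_mfderiv hf p).bijective.2 v
    rw [hσ p, hΩ.alternating]
  closed := by
    intro q U V X hU hV hX
    obtain ⟨p, rfl⟩ := hsurj q
    have hi := isInvertible_mfderiv hf p
    have h := hΩ.closed p _ _ _
      (hU.mpullback_vectorField_preimage (hf p).contMDiffAt hi (by simp))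
      (hV.mpullback_vectorField_preimage (hf p).contMDiffAt hi (by simp))
      (hX.mpullback_vectorField_preimage (hf p).contMDiffAt hi (by simp))
    unfold extDerivTwo at h ⊢
    rw [hσ.dirDeriv_eq hf (hσ.contMDiffAt_apply hf hΩ hV hX),
      hσ.dirDeriv_eq hf (hσ.contMDiffAt_apply hf hΩ hU hX),
      hσ.dirDeriv_eq hf (hσ.contMDiffAt_apply hf hΩ hU hV),
      hσ.apply_mlieBracket hf hU hV, hσ.apply_mlieBracket hf hU hX,
      hσ.apply_mlieBracket hf hV hX] at h
    exact h
  nondegenerate := by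
    intro q v hv
    obtain ⟨p, rfl⟩ := hsurj q
    obtain ⟨v, rfl⟩ := (isInvertible_mfderiv hf p).bijective.2 v
    rw [hΩ.nondegenerate p v fun w => by rw [← hσ p]; exact hv _, map_zero]

end IsPullback

end Pushforward

/-! ### The coadjoint orbit as a hamiltonian space -/

section OrbitForm

variable {E : Type*} [NormedAddCommGroup E] [NormedSpace ℝ E] [FiniteDimensional ℝ E]
  {G : Type*} [TopologicalSpace G] [SecondCountableTopology G] [ChartedSpace E G] [Group G]
  [LieGroup 𝓘(ℝ, E) ∞ G]
  {F : Type*} [NormedAddCommGroup F] [NormedSpace ℝ F] [FiniteDimensional ℝ F]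
  {M : Type*} [TopologicalSpace M] [T2Space M] [ChartedSpace F M] [IsManifold 𝓘(ℝ, F) ∞ M]
  [MulAction G M]
  {Ω : BilinField 𝓘(ℝ, F) M} {μ : M → LieDual 𝓘(ℝ, E) G}

namespace IsHamiltonianSpace

variable (hM : IsHamiltonianSpace 𝓘(ℝ, E) 𝓘(ℝ, F) Ω μ) (p₀ : M)
  [ChartedSpace (EuclideanSpace ℝ (Fin (Module.finrank ℝ F))) (CoadjointOrbit 𝓘(ℝ, E) (μ p₀))]

/-- Near `(g, β)`, the action on the orbit is the action on `M` followed by the moment map, in terms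
of a local inverse of the moment map at `β`. -/
theorem contMDiffSMul_orbit (hM : IsHamiltonianSpace 𝓘(ℝ, E) 𝓘(ℝ, F) Ω μ)
    (hC : HasComponentCharts (Module.finrank ℝ F) (μ p₀)) :
    ContMDiffSMul 𝓘(ℝ, E) (𝓡 (Module.finrank ℝ F)) ∞ G (CoadjointOrbit 𝓘(ℝ, E) (μ p₀)) := by
  refine ⟨fun x => ?_⟩
  obtain ⟨g, β⟩ := x
  obtain ⟨p, rfl⟩ := hM.surjective_momentLift p₀ β
  have hf := hM.isLocalDiffeomorph_momentLift p₀ hC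
  have hs := hM.smooth_action.contMDiff_smul
  have h1 : ContMDiffAt (𝓘(ℝ, E).prod (𝓡 (Module.finrank ℝ F))) 𝓘(ℝ, F) ∞
      (fun y : G × CoadjointOrbit 𝓘(ℝ, E) (μ p₀) => (hf p).localInverse y.2)
      (g, momentLift hM p₀ p) :=
    (hf p).localInverse_contMDiffAt.comp (g, momentLift hM p₀ p) contMDiffAt_snd
  have h2 : ContMDiffAt (𝓘(ℝ, E).prod (𝓡 (Module.finrank ℝ F))) 𝓘(ℝ, F) ∞
      (fun y : G × CoadjointOrbit 𝓘(ℝ, E) (μ p₀) => y.1 • (hf p).localInverse y.2)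
      (g, momentLift hM p₀ p) :=
    hs.contMDiffAt.comp (g, momentLift hM p₀ p) (contMDiffAt_fst.prodMk h1)
  refine ((hf.contMDiff.contMDiffAt).comp _ h2).congr_of_eventuallyEq ?_
  have h3 := (continuousAt_snd (p := (g, momentLift hM p₀ p))).eventually
    (hf p).localInverse_eventuallyEq_right
  filter_upwards [h3] with y hy
  change momentLift hM p₀ ((hf p).localInverse y.2) = y.2 at hy
  change _ = momentLift hM p₀ (y.1 • _)
  rw [hM.momentLift_smul, hy]

/-- The moment map carries fundamental vector fields to fundamental vector fields. -/
theorem tanMap_momentLift_fundamentalField (hC : HasComponentCharts (Module.finrank ℝ F) (μ p₀))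
    (X : GroupLieAlgebra 𝓘(ℝ, E) G) (p : M) :
    tanMap F (EuclideanSpace ℝ (Fin (Module.finrank ℝ F))) (momentLift hM p₀) p
        (fundamentalField 𝓘(ℝ, E) 𝓘(ℝ, F) X p)
      = fundamentalField 𝓘(ℝ, E) (𝓡 (Module.finrank ℝ F)) X (momentLift hM p₀ p) := by
  have hf := (hM.isLocalDiffeomorph_momentLift p₀ hC).contMDiff
  have key : ∀ q, (1 : G) • p = q → ∀ Z : E,
      tanMap F (EuclideanSpace ℝ (Fin (Module.finrank ℝ F))) (momentLift hM p₀) q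
        (tanMap E F (fun g : G => g • p) 1 Z)
      = tanMap E (EuclideanSpace ℝ (Fin (Module.finrank ℝ F)))
        (fun g : G => g • momentLift hM p₀ p) 1 Z := by
    rintro _ rfl Z
    have h1 := tanMap_comp (f := fun g : G => g • p)
      ((hf ((1 : G) • p)).mdifferentiableAt (by simp))
      ((contMDiff_orbit hM.smooth_action p 1).mdifferentiableAt (by simp))
    have h2 : momentLift hM p₀ ∘ (fun g : G => g • p) = fun g : G => g • momentLift hM p₀ p :=
      funext fun g => hM.momentLift_smul p₀ g p
    rw [h2] at h1
    exact (DFunLike.congr_fun h1 Z).symm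
  exact key p (one_smul G p) X

/-- The symplectic form descends to the orbit: two points over the same point of the orbit have the
same values `μ p ⁅X, Y⁆` of the form on fundamental vector fields. -/
theorem exists_form_orbit (hC : HasComponentCharts (Module.finrank ℝ F) (μ p₀)) :
    ∃ σ : BilinField (𝓡 (Module.finrank ℝ F)) (CoadjointOrbit 𝓘(ℝ, E) (μ p₀)),
      IsPullback (momentLift hM p₀) Ω σ := by
  have key : ∀ β : CoadjointOrbit 𝓘(ℝ, E) (μ p₀),
      ∃ B : EuclideanSpace ℝ (Fin (Module.finrank ℝ F)) →L[ℝ]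
        EuclideanSpace ℝ (Fin (Module.finrank ℝ F)) →L[ℝ] ℝ,
      ∀ p, momentLift hM p₀ p = β → ∀ v w : F,
        B (tanMap F (EuclideanSpace ℝ (Fin (Module.finrank ℝ F))) (momentLift hM p₀) p v)
          (tanMap F (EuclideanSpace ℝ (Fin (Module.finrank ℝ F))) (momentLift hM p₀) p w)
        = Ω p v w := by
    intro β
    obtain ⟨p, rfl⟩ := hM.surjective_momentLift p₀ β
    let A : F →L[ℝ] EuclideanSpace ℝ (Fin (Module.finrank ℝ F)) :=
      tanMap F (EuclideanSpace ℝ (Fin (Module.finrank ℝ F))) (momentLift hM p₀) p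
    have hA : A.IsInvertible :=
      isInvertible_mfderiv (hM.isLocalDiffeomorph_momentLift p₀ hC) p
    let B : F →L[ℝ] F →L[ℝ] ℝ := Ω p
    refine ⟨B.bilinearComp A.inverse A.inverse, fun p' hp' v w => ?_⟩
    obtain ⟨X, rfl⟩ := hM.surjective_fundamentalField p' v
    obtain ⟨Y, rfl⟩ := hM.surjective_fundamentalField p' w
    have h1 : ∀ Z : GroupLieAlgebra 𝓘(ℝ, E) G,
        tanMap F (EuclideanSpace ℝ (Fin (Module.finrank ℝ F))) (momentLift hM p₀) p'
          (fundamentalField 𝓘(ℝ, E) 𝓘(ℝ, F) Z p')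
        = A (fundamentalField 𝓘(ℝ, E) 𝓘(ℝ, F) Z p) := by
      intro Z
      refine (hM.tanMap_momentLift_fundamentalField p₀ hC Z p').trans ?_
      rw [hp']
      exact (hM.tanMap_momentLift_fundamentalField p₀ hC Z p).symm
    have h2 : μ p' = μ p := congrArg Subtype.val hp'
    have h3 : ∀ v w : F, B (A.inverse (A v)) (A.inverse (A w)) = B v w := fun v w => by
      rw [hA.inverse_apply_self, hA.inverse_apply_self]
    rw [h1, h1]
    refine (h3 _ _).trans ((hM.form_fundamentalField X Y p).trans ?_)
    rw [← h2]
    exact (hM.form_fundamentalField X Y p').symm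
  choose σ hσ using key
  exact ⟨σ, fun p v w => hσ _ p rfl v w⟩

theorem isOrbitManifold (hM : IsHamiltonianSpace 𝓘(ℝ, E) 𝓘(ℝ, F) Ω μ)
    (hC : HasComponentCharts (Module.finrank ℝ F) (μ p₀)) :
    IsOrbitManifold (I := 𝓘(ℝ, E)) (𝓡 (Module.finrank ℝ F)) (μ p₀) := by
  have := hM.homogeneous
  have hf := hM.isLocalDiffeomorph_momentLift p₀ hC
  have h1 : CoadjointOrbit.orbitMap (μ p₀) = momentLift hM p₀ ∘ fun g : G => g • p₀ :=
    funext (hM.orbitMap_eq_momentLift p₀)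
  refine ⟨hM.t2Space_orbit p₀, ?_, hC.isManifold, ?_, fun g => ?_⟩
  · exact ((isOpenMap_orbitMap (μ p₀)).isQuotientMap (continuous_orbitMap _)
      (surjective_orbitMap _)).secondCountableTopology (isOpenMap_orbitMap _)
  · rw [h1]
    exact hf.contMDiff.comp (contMDiff_orbit hM.smooth_action p₀)
  · have h2 := tanMap_comp (f := fun g : G => g • p₀) ((hf (g • p₀)).mdifferentiableAt (by simp))
      ((contMDiff_orbit hM.smooth_action p₀ g).mdifferentiableAt (n := ∞) (by simp))
    rw [← h1] at h2
    change Function.Surjective (tanMap E (EuclideanSpace ℝ (Fin (Module.finrank ℝ F)))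
      (CoadjointOrbit.orbitMap (μ p₀)) g)
    rw [h2]
    exact (isInvertible_mfderiv hf (g • p₀)).bijective.2.comp
      (surjective_tanMap_orbit hM.smooth_action p₀ g)

variable {σ : BilinField (𝓡 (Module.finrank ℝ F)) (CoadjointOrbit 𝓘(ℝ, E) (μ p₀))}

theorem isKKSForm (hC : HasComponentCharts (Module.finrank ℝ F) (μ p₀))
    (hσ : IsPullback (momentLift hM p₀) Ω σ) :
    IsKKSForm (I := 𝓘(ℝ, E)) (𝓡 (Module.finrank ℝ F)) σ := by
  intro β X Y
  obtain ⟨p, rfl⟩ := hM.surjective_momentLift p₀ β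
  rw [← hM.tanMap_momentLift_fundamentalField p₀ hC, ← hM.tanMap_momentLift_fundamentalField p₀ hC]
  exact (hσ p _ _).trans (hM.form_fundamentalField X Y p)

theorem isHamiltonianSpace_orbit (hC : HasComponentCharts (Module.finrank ℝ F) (μ p₀))
    [IsManifold (𝓡 (Module.finrank ℝ F)) ∞ (CoadjointOrbit 𝓘(ℝ, E) (μ p₀))]
    (hσ : IsPullback (momentLift hM p₀) Ω σ) :
    IsHamiltonianSpace 𝓘(ℝ, E) (𝓡 (Module.finrank ℝ F)) σ CoadjointOrbit.incl where
  symplectic := by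
    have := FiniteDimensional.complete ℝ F
    exact IsPullback.isSymplecticForm (f := momentLift hM p₀) hσ
      (hM.isLocalDiffeomorph_momentLift p₀ hC) (hM.surjective_momentLift p₀) hM.symplectic
  smooth_action := hM.contMDiffSMul_orbit p₀ hC
  homogeneous := by
    have := hM.homogeneous
    refine ⟨fun β γ => ?_⟩
    obtain ⟨p, rfl⟩ := hM.surjective_momentLift p₀ β
    obtain ⟨q, rfl⟩ := hM.surjective_momentLift p₀ γ
    obtain ⟨g, rfl⟩ := MulAction.exists_smul_eq G p q
    exact ⟨g, (hM.momentLift_smul p₀ g p).symm⟩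
  invariant := by
    intro g β v w
    obtain ⟨p, rfl⟩ := hM.surjective_momentLift p₀ β
    have hf := hM.isLocalDiffeomorph_momentLift p₀ hC
    have hd : ∀ q, MDifferentiableAt 𝓘(ℝ, F) (𝓡 (Module.finrank ℝ F)) (momentLift hM p₀) q :=
      fun q => (hf q).mdifferentiableAt (by simp)
    have hg : ContMDiff (𝓡 (Module.finrank ℝ F)) (𝓡 (Module.finrank ℝ F)) ∞
        (fun β : CoadjointOrbit 𝓘(ℝ, E) (μ p₀) => g • β) :=
      contMDiff_act (hM.contMDiffSMul_orbit p₀ hC) g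
    have h1 := tanMap_comp ((hg (momentLift hM p₀ p)).mdifferentiableAt (by simp)) (hd p)
    have h2 := tanMap_comp (hd (g • p))
      ((contMDiff_act hM.smooth_action g p).mdifferentiableAt (n := ∞) (by simp))
    have h3 : (fun β : CoadjointOrbit 𝓘(ℝ, E) (μ p₀) => g • β) ∘ momentLift hM p₀
        = momentLift hM p₀ ∘ (fun q => g • q) := funext fun q => (hM.momentLift_smul p₀ g q).symm
    rw [h3, h2] at h1
    obtain ⟨v, rfl⟩ := (isInvertible_mfderiv hf p).bijective.2 v
    obtain ⟨w, rfl⟩ := (isInvertible_mfderiv hf p).bijective.2 w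
    -- `g • momentLift p` and `momentLift (g • p)` are equal, but not by definition
    have h4 : ∀ β, momentLift hM p₀ (g • p) = β → ∀ v w : F,
        σ β (tanMap F (EuclideanSpace ℝ (Fin (Module.finrank ℝ F))) (momentLift hM p₀) (g • p) v)
          (tanMap F (EuclideanSpace ℝ (Fin (Module.finrank ℝ F))) (momentLift hM p₀) (g • p) w)
        = Ω (g • p) v w := by
      rintro _ rfl v w
      exact hσ (g • p) v w
    refine Eq.trans ?_ ((h4 _ (hM.momentLift_smul p₀ g p)
      (tanMap F F (fun q => g • q) p v) (tanMap F F (fun q => g • q) p w)).trans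
        ((hM.invariant g p v w).trans (hσ p v w).symm))
    exact congrArg₂ (fun a b : EuclideanSpace ℝ (Fin (Module.finrank ℝ F)) =>
      σ (g • momentLift hM p₀ p) a b) (DFunLike.congr_fun h1 v).symm (DFunLike.congr_fun h1 w).symm
  comoment_smooth := hC.contMDiff_incl
  moment := by
    intro X β v
    obtain ⟨p, rfl⟩ := hM.surjective_momentLift p₀ β
    have hf := hM.isLocalDiffeomorph_momentLift p₀ hC
    obtain ⟨v, rfl⟩ := (isInvertible_mfderiv hf p).bijective.2 v
    have h1 := tanMap_comp ((hC.contMDiff_incl X (momentLift hM p₀ p)).mdifferentiableAt (by simp))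
      ((hf p).mdifferentiableAt (by simp))
    refine (DFunLike.congr_fun h1 v).symm.trans ((hM.moment X p v).trans ?_)
    rw [← hM.tanMap_momentLift_fundamentalField p₀ hC]
    exact (hσ p _ _).symm
  equivariant := fun g β => rfl

end IsHamiltonianSpace

end OrbitForm

end KKS

theorem mainTheorem3
    {E : Type*} [NormedAddCommGroup E] [NormedSpace ℝ E] [FiniteDimensional ℝ E]
    {G : Type*} [TopologicalSpace G] [T2Space G] [SecondCountableTopology G]
    [ChartedSpace E G] [Group G] [LieGroup 𝓘(ℝ, E) ∞ G] [ConnectedSpace G]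
    {F : Type*} [NormedAddCommGroup F] [NormedSpace ℝ F] [FiniteDimensional ℝ F]
    {M : Type*} [TopologicalSpace M] [T2Space M] [SecondCountableTopology M]
    [ChartedSpace F M] [IsManifold 𝓘(ℝ, F) ∞ M] [SimplyConnectedSpace M]
    [MulAction G M]
    (Ω : KKS.BilinField 𝓘(ℝ, F) M) (μ : M → KKS.LieDual 𝓘(ℝ, E) G)
    (hM : KKS.IsHamiltonianSpace 𝓘(ℝ, E) 𝓘(ℝ, F) Ω μ) :
    ∃ (α : KKS.LieDual 𝓘(ℝ, E) G) (f : M → KKS.CoadjointOrbit 𝓘(ℝ, E) α),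
      -- `f` is `μ` with its codomain restricted to the coadjoint orbit of `α`
      (∀ p : M, (f p).incl = μ p) ∧
      ∃ (n : ℕ) (_ : ChartedSpace (EuclideanSpace ℝ (Fin n)) (KKS.CoadjointOrbit 𝓘(ℝ, E) α))
        (hO : KKS.IsOrbitManifold (𝓡 n) α)
        (σ : KKS.BilinField (𝓡 n) (KKS.CoadjointOrbit 𝓘(ℝ, E) α)),
        KKS.IsKKSForm (𝓡 n) σ ∧
        (haveI := hO.manifold
         KKS.IsHamiltonianSpace 𝓘(ℝ, E) (𝓡 n) σ KKS.CoadjointOrbit.incl) ∧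
        KKS.IsUniversalCover f ∧
        (∀ (g : G) (p : M), f (g • p) = g • f p) ∧
        KKS.IsSymplecticCovering Ω σ f := by
  obtain ⟨p₀⟩ : Nonempty M := inferInstance
  obtain ⟨C, hC⟩ := hM.exists_hasComponentCharts p₀
  obtain ⟨σ, hσ⟩ := hM.exists_form_orbit p₀ hC
  have hO := hM.isOrbitManifold p₀ hC
  have := hO.manifold
  have hcov := hM.isCoveringMap_momentLift p₀
  have hsurj := hM.surjective_momentLift p₀
  exact ⟨μ p₀, KKS.momentLift hM p₀, fun _ => rfl, Module.finrank ℝ F, C, hO, σ,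
    hM.isKKSForm p₀ hC hσ, hM.isHamiltonianSpace_orbit p₀ hC hσ, ⟨inferInstance, hcov, hsurj⟩,
    hM.momentLift_smul p₀,
    ⟨hcov, hsurj, hM.isLocalDiffeomorph_momentLift p₀ hC, hσ⟩⟩
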